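/- **Theorem.** Let $0\le\alpha\le 1$. Let $\mathrm{Comb}(\mathbb Z,\mathbb Z)$ be the graph obtained from the square lattice $\mathbb Z^2$ by removing all horizontal edges whose vertical coordinate is not $0$, and let $\mathrm{Comb}_\ell(\mathbb Z,\alpha)$ be the subgraph of it obtained by retaining the vertices $(n,x)$ with $n\in\mathbb Z$ and $0\le x\le \bigl(\log(|n|\vee 1)\bigr)^{\alpha}$ (where $0^0=1$), together with all edges between them. Let $X=(X_n)_{n\ge0}$, $Y=(Y_n)_{n\ge0}$ and $Z=(Z_n)_{n\ge0}$ be independent simple random walks on $\mathrm{Comb}_\ell(\mathbb Z,\alpha)$, all started at the origin $(0,0)$, and for $N\ge1$ let $$C_N=\sum_{n=1}^{N}\mathbf 1_{\{X_n=Y_n=Z_n\}}$$ be the number of their triple collisions up to time $N$. Then, almost surely, $$\limsup_{N\to\infty}\frac{C_N}{(\log N)^{1-\alpha}\vee\log\log N}>0,$$ where the value $+\infty$ of the limsup is allowed. -/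

import Mathlib

open Filter MeasureTheory ProbabilityTheory

/-- The graph `Comb(ℤ, ℤ)`: the square lattice on `ℤ × ℤ` with every horizontal edge removed
except those on the horizontal axis. -/
def combZ : SimpleGraph (ℤ × ℤ) where
  Adj p q := (p.1 = q.1 ∧ |p.2 - q.2| = 1) ∨ (p.2 = 0 ∧ q.2 = 0 ∧ |p.1 - q.1| = 1)
  symm := ⟨by
    rintro p q (⟨h, h'⟩ | ⟨h, h', h''⟩)
    · exact Or.inl ⟨h.symm, by rwa [abs_sub_comm]⟩
    · exact Or.inr ⟨h', h, by rwa [abs_sub_comm]⟩⟩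
  loopless := ⟨by
    rintro p (⟨_, h⟩ | ⟨_, _, h⟩) <;> simp at h⟩

/-- The vertices `(n, x)` of the comb with logarithmic teeth: `0 ≤ x ≤ (log (|n| ∨ 1)) ^ α`. -/
def combLogVertices (α : ℝ) : Set (ℤ × ℤ) :=
  {p | 0 ≤ p.2 ∧ (p.2 : ℝ) ≤ Real.log (max |(p.1 : ℝ)| 1) ^ α}

/-- The graph `Comb_ℓ(ℤ, α)`: the subgraph of `Comb(ℤ, ℤ)` obtained by retaining the vertices
in `combLogVertices α`. -/
def combLog (α : ℝ) : SimpleGraph (combLogVertices α) :=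
  combZ.induce (combLogVertices α)

/-- The origin, as a vertex of `Comb_ℓ(ℤ, α)`. -/
def combLogOrigin (α : ℝ) : combLogVertices α :=
  ⟨(0, 0), le_rfl, by
    simpa using Real.rpow_nonneg (le_refl (0 : ℝ)) α⟩

theorem combLog_neighborSet_finite (α : ℝ) (v : combLogVertices α) :
    ((combLog α).neighborSet v).Finite := by
  refine Set.Finite.of_finite_image (f := Subtype.val) ?_ Subtype.val_injective.injOn
  refine (Set.finite_Icc (v.1.1 - 1, v.1.2 - 1) (v.1.1 + 1, v.1.2 + 1)).subset ?_
  rintro _ ⟨w, hw, rfl⟩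
  have hw' : (v.1.1 = w.1.1 ∧ |v.1.2 - w.1.2| = 1) ∨
      (v.1.2 = 0 ∧ w.1.2 = 0 ∧ |v.1.1 - w.1.1| = 1) := hw
  rw [Set.mem_Icc, Prod.le_def, Prod.le_def]
  rcases hw' with ⟨h, h'⟩ | ⟨h, h', h''⟩
  · have := abs_le.1 h'.le
    refine ⟨⟨?_, ?_⟩, ⟨?_, ?_⟩⟩ <;> dsimp only <;> omega
  · have := abs_le.1 h''.le
    refine ⟨⟨?_, ?_⟩, ⟨?_, ?_⟩⟩ <;> dsimp only <;> omega

noncomputable instance combLogLocallyFinite (α : ℝ) : (combLog α).LocallyFinite :=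
  fun v => (combLog_neighborSet_finite α v).fintype

open Classical in
/-- Transition probability of the simple random walk on a locally finite graph: from `x`, jump
to a uniformly chosen neighbour. -/
noncomputable def srwStep {V : Type*} (G : SimpleGraph V) [G.LocallyFinite] (x y : V) : ℝ :=
  if G.Adj x y then 1 / (G.degree x : ℝ) else 0

/-- `X` is a simple random walk on `G` started at `o`, that is, a Markov chain with
`X₀ = o` almost surely and
`P(X₀ = x₀, …, Xₙ = xₙ, Xₙ₊₁ = y) = P(X₀ = x₀, …, Xₙ = xₙ) * srwStep G xₙ y`. -/
structure IsSimpleRandomWalk {V Ω : Type*} [MeasurableSpace V] [MeasurableSpace Ω]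
    (G : SimpleGraph V) [G.LocallyFinite] (o : V) (P : Measure Ω) (X : ℕ → Ω → V) : Prop where
  measurable : ∀ n, Measurable (X n)
  start : ∀ᵐ ω ∂P, X 0 ω = o
  markov : ∀ (n : ℕ) (x : ℕ → V) (y : V),
    P.real {ω | (∀ k ≤ n, X k ω = x k) ∧ X (n + 1) ω = y} =
      P.real {ω | ∀ k ≤ n, X k ω = x k} * srwStep G (x n) y

open Classical in
/-- The number of collisions of the trajectories `x`, `y`, `z` in the time interval `[1, N]`. -/
noncomputable def tripleCollisions {V : Type*} (x y z : ℕ → V) (N : ℕ) : ℕ :=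
  ((Finset.Icc 1 N).filter (fun n => x n = y n ∧ y n = z n)).card

/-! The proof is a second moment argument, run conditionally on an arbitrary finite history of the
three walks. Write `colRate α j` $= 1/(j\,\ell(j))$ with $\ell(j) = (\log j)^\alpha$. This is the
order of the probability that three walks started at one vertex $x$ coincide at time $j$, and
summing it up to $N$ gives the order of `rate α N`.

Upper bound. The triple collision probability $\sum_w p_j(x,w)^3$ is at most $\max_w p_j(x,w)^2$. An
energy argument gives $p_{2n}(v,v) \lesssim 1/|B| + D/n$ whenever the vertices of $B$ lie within
distance $D$ of $v$ (`dens_diag_le`). For $B$ a block of $r$ consecutive teeth with $r^2\ell(n)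
\approx n$, this is $1/\sqrt{n\,\ell(n)}$ (`dens_diag_le_log`). The block must dominate the tooth at
$v$, which can have height $\log N$. Times below a power of $\log N$ are therefore handled by the
cruder bound $1/j$ for the collision probability and contribute $O(\log\log N)$, which the maximum
in the normalisation absorbs (`eventually_split_le`).

Lower bound. A Lyapunov function shows that the walk is at horizontal distance $O(r)$ at time $n$
with probability at least $1/2$. Such a box has $O(r\,\ell(n))$ vertices, so the power mean
inequality gives $\sum_w p_n(x,w)^3 \gtrsim 1/(r\,\ell(n))^2 \approx 1/(n\,\ell(n))$
(`sum_heat_cube_ge`). Replacing the common starting point by three points of equal parity costs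
$O(j^{-9/8})$ at time $j$, which is summable (`exists_sum_mul_abs_sub_le`).

After a collision the expected number of further ones is again $O($`rate`$)$, so a Paley–Zygmund
inequality (`paley_zygmund`) gives at least $c\cdot$`rate α N` collisions with conditional
probability at least $\delta$, where $c$ and $\delta$ do not depend on the history
(`exists_eventually_real_collisions_ge`). Hence this happens for infinitely many $N$ with
conditional probability at least $\delta$ given any history, and such an event has probability one
(`measure_eq_zero_of_history_atoms`). -/

/-! ### Heat kernel and Dirichlet energy on a locally finite graph -/

section GraphHeatKernel

variable {V : Type*} (G : SimpleGraph V) [G.LocallyFinite]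

/-- The averaging operator of the simple random walk on `G`. -/
noncomputable def avg (f : V → ℝ) (x : V) : ℝ :=
  (∑ z ∈ G.neighborFinset x, f z) / G.degree x

open Classical in
/-- The indicator function of the vertex `v`. -/
noncomputable def pointMass (v : V) : V → ℝ := fun x => if x = v then 1 else 0

/-- The `n`-step transition probability from `x` to `w`. -/
noncomputable def heat (n : ℕ) (x w : V) : ℝ := (avg G)^[n] (pointMass w) x

/-- The `n`-step transition density with respect to the degree measure. -/
noncomputable def dens (n : ℕ) (v : V) : V → ℝ := (avg G)^[n] (fun x => pointMass v x / G.degree v)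

/-- The inner product of finitely supported functions, with vertices weighted by degree. -/
noncomputable def ip (f g : V → ℝ) : ℝ := ∑' x, G.degree x * (f x * g x)

variable {G}

theorem avg_mono {f g : V → ℝ} (h : ∀ x, f x ≤ g x) (x : V) : avg G f x ≤ avg G g x := by
  unfold avg
  gcongr
  exact h _

theorem avg_iter_mono {f g : V → ℝ} (h : ∀ x, f x ≤ g x) (n : ℕ) (x : V) :
    (avg G)^[n] f x ≤ (avg G)^[n] g x := by
  induction n generalizing x with
  | zero => exact h x
  | succ n ih => simp only [Function.iterate_succ_apply']; exact avg_mono ih x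

theorem avg_add (f g : V → ℝ) : avg G (f + g) = avg G f + avg G g := by
  funext x; simp [avg, Finset.sum_add_distrib, add_div]

theorem avg_smul (c : ℝ) (f : V → ℝ) : avg G (c • f) = c • avg G f := by
  funext x; simp [avg, ← Finset.mul_sum, mul_div_assoc]

theorem avg_iter_add (n : ℕ) (f g : V → ℝ) :
    (avg G)^[n] (f + g) = (avg G)^[n] f + (avg G)^[n] g := by
  induction n with
  | zero => rfl
  | succ n ih => simp only [Function.iterate_succ_apply', ih, avg_add]

theorem avg_iter_smul (n : ℕ) (c : ℝ) (f : V → ℝ) :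
    (avg G)^[n] (c • f) = c • (avg G)^[n] f := by
  induction n with
  | zero => rfl
  | succ n ih => simp only [Function.iterate_succ_apply', ih, avg_smul]

theorem avg_iter_zero (n : ℕ) : (avg G)^[n] (0 : V → ℝ) = 0 := by
  have := avg_iter_smul (G := G) n 0 0
  simpa using this

theorem avg_iter_sum {ι : Type*} (n : ℕ) (s : Finset ι) (f : ι → V → ℝ) :
    (avg G)^[n] (∑ i ∈ s, f i) = ∑ i ∈ s, (avg G)^[n] (f i) := by
  classical
  induction s using Finset.induction_on with
  | empty => simpa using avg_iter_zero n
  | insert a s ha ih => rw [Finset.sum_insert ha, Finset.sum_insert ha, avg_iter_add, ih]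

theorem avg_const (hd : ∀ x, 0 < G.degree x) (c : ℝ) : avg G (fun _ => c) = fun _ => c := by
  funext x
  have : (G.degree x : ℝ) ≠ 0 := by exact_mod_cast (hd x).ne'
  simp [avg]
  field_simp

theorem avg_iter_const (hd : ∀ x, 0 < G.degree x) (n : ℕ) (c : ℝ) :
    (avg G)^[n] (fun _ => c) = fun _ => c := by
  induction n with
  | zero => rfl
  | succ n ih => rw [Function.iterate_succ_apply', ih, avg_const hd]

theorem avg_iter_nonneg {f : V → ℝ} (h : ∀ x, 0 ≤ f x) (n : ℕ) (x : V) :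
    0 ≤ (avg G)^[n] f x := by
  have := avg_iter_mono (G := G) (f := 0) (g := f) h n x
  simpa [avg_iter_zero] using this

theorem pointMass_nonneg (v x : V) : 0 ≤ pointMass v x := by
  unfold pointMass; split_ifs <;> norm_num

theorem heat_nonneg (n : ℕ) (x w : V) : 0 ≤ heat G n x w :=
  avg_iter_nonneg (pointMass_nonneg w) n x

theorem heat_zero_self (x : V) : heat G 0 x x = 1 := by simp [heat, pointMass]

theorem sum_heat (n : ℕ) (x : V) (S : Finset V) :
    ∑ w ∈ S, heat G n x w = (avg G)^[n] (∑ w ∈ S, pointMass w) x := by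
  rw [avg_iter_sum]; simp [heat]

open Classical in
theorem sum_pointMass (S : Finset V) (x : V) :
    (∑ w ∈ S, pointMass w) x = if x ∈ S then 1 else 0 := by
  simp only [Finset.sum_apply, pointMass]
  convert Finset.sum_ite_eq S x (fun _ => (1 : ℝ))

theorem sum_heat_le_one (hd : ∀ x, 0 < G.degree x) (n : ℕ) (x : V) (S : Finset V) :
    ∑ w ∈ S, heat G n x w ≤ 1 := by
  classical
  rw [sum_heat]
  have := avg_iter_mono (G := G) (f := ∑ w ∈ S, pointMass w) (g := fun _ => 1)
    (fun y => by rw [sum_pointMass]; split_ifs <;> norm_num) n x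
  rwa [avg_iter_const hd] at this

theorem heat_le_one (hd : ∀ x, 0 < G.degree x) (n : ℕ) (x w : V) : heat G n x w ≤ 1 := by
  simpa using sum_heat_le_one hd n x {w}

theorem dens_eq_heat_div (n : ℕ) (v x : V) : dens G n v x = heat G n x v / G.degree v := by
  have : (fun x => pointMass v x / (G.degree v : ℝ)) = ((G.degree v : ℝ)⁻¹) • pointMass v := by
    funext x; simp [div_eq_inv_mul]
  unfold dens heat
  rw [this, avg_iter_smul]; simp [div_eq_inv_mul]

theorem dens_succ (n : ℕ) (v : V) : dens G (n + 1) v = avg G (dens G n v) :=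
  Function.iterate_succ_apply' _ _ _

theorem dens_nonneg (n : ℕ) (v x : V) : 0 ≤ dens G n v x := by
  rw [dens_eq_heat_div]; exact div_nonneg (heat_nonneg _ _ _) (Nat.cast_nonneg _)

theorem support_avg_finite {f : V → ℝ} (hf : f.support.Finite) : (avg G f).support.Finite := by
  refine (hf.biUnion (t := fun z => (G.neighborFinset z : Set V))
    fun z _ => Finset.finite_toSet _).subset ?_
  intro x hx
  obtain ⟨z, hz, hz'⟩ : ∃ z ∈ G.neighborFinset x, f z ≠ 0 := by
    by_contra! h
    exact hx (by simp [avg, Finset.sum_eq_zero h])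
  simp only [SimpleGraph.mem_neighborFinset] at hz
  simp only [Set.mem_iUnion]
  exact ⟨z, hz', by simpa using hz.symm⟩

theorem support_dens_finite (n : ℕ) (v : V) : (dens G n v).support.Finite := by
  induction n with
  | zero =>
    refine (Set.finite_singleton v).subset fun x hx => ?_
    by_contra h
    exact hx (by simp [dens, pointMass, show x ≠ v from h])
  | succ n ih => rw [dens_succ]; exact support_avg_finite ih

theorem summable_ip {f : V → ℝ} (hf : f.support.Finite) (g : V → ℝ) :
    Summable fun x => (G.degree x : ℝ) * (f x * g x) := by
  refine summable_of_ne_finset_zero (s := hf.toFinset) fun x hx => ?_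
  have : f x = 0 := by simpa using hx
  simp [this]

theorem ip_comm (f g : V → ℝ) : ip G f g = ip G g f := by
  unfold ip; simp_rw [mul_comm (f _)]

theorem ip_add_left {f f' : V → ℝ} (hf : f.support.Finite) (hf' : f'.support.Finite) (g : V → ℝ) :
    ip G (f + f') g = ip G f g + ip G f' g := by
  unfold ip
  rw [← (summable_ip hf g).tsum_add (summable_ip hf' g)]
  congr 1; funext x; simp; ring

theorem ip_sub_left {f f' : V → ℝ} (hf : f.support.Finite) (hf' : f'.support.Finite) (g : V → ℝ) :
    ip G (f - f') g = ip G f g - ip G f' g := by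
  unfold ip
  rw [← (summable_ip hf g).tsum_sub (summable_ip hf' g)]
  congr 1; funext x; simp; ring

theorem ip_self_nonneg (f : V → ℝ) : 0 ≤ ip G f f :=
  tsum_nonneg fun _ => mul_nonneg (Nat.cast_nonneg _) (mul_self_nonneg _)

theorem support_add_finite {f g : V → ℝ} (hf : f.support.Finite) (hg : g.support.Finite) :
    (f + g).support.Finite :=
  (hf.union hg).subset (Function.support_add f g)

theorem support_sub_finite {f g : V → ℝ} (hf : f.support.Finite) (hg : g.support.Finite) :
    (f - g).support.Finite :=
  (hf.union hg).subset (Function.support_sub f g)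

theorem ip_sub_sub {f g : V → ℝ} (hf : f.support.Finite) (hg : g.support.Finite) :
    ip G (f - g) (f - g) = ip G f f - 2 * ip G f g + ip G g g := by
  rw [ip_sub_left hf hg, ip_comm f, ip_comm g, ip_sub_left hf hg, ip_sub_left hf hg, ip_comm g f]
  ring

theorem sum_sq_le_ip (hd : ∀ x, 0 < G.degree x) {f : V → ℝ} (hf : f.support.Finite)
    (S : Finset V) : ∑ x ∈ S, f x ^ 2 ≤ ip G f f := by
  refine le_trans (Finset.sum_le_sum fun x _ => ?_)
    ((summable_ip hf f).sum_le_tsum S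
      fun _ _ => mul_nonneg (Nat.cast_nonneg _) (mul_self_nonneg _))
  have : (1 : ℝ) ≤ G.degree x := by exact_mod_cast hd x
  nlinarith [sq_nonneg (f x)]

/-- Sums over directed edges may be reversed. -/
theorem tsum_neighbor_symm {F : V → V → ℝ} {s : Set V} (hs : s.Finite)
    (hF : ∀ x y, F x y ≠ 0 → x ∈ s ∨ y ∈ s) :
    ∑' x, ∑ y ∈ G.neighborFinset x, F x y = ∑' x, ∑ y ∈ G.neighborFinset x, F y x := by
  classical
  set T : Set V := s ∪ ⋃ z ∈ s, (G.neighborFinset z : Set V) with hT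
  have hTf : T.Finite := hs.union (hs.biUnion fun z _ => Finset.finite_toSet _)
  have key : ∀ x y, G.Adj x y → F x y ≠ 0 → x ∈ T ∧ y ∈ T := by
    intro x y hxy h
    rcases hF x y h with h | h
    · refine ⟨Or.inl h, Or.inr ?_⟩
      simp only [Set.mem_iUnion]
      exact ⟨x, h, by simpa using hxy⟩
    · refine ⟨Or.inr ?_, Or.inl h⟩
      simp only [Set.mem_iUnion]
      exact ⟨y, h, by simpa using hxy.symm⟩
  set U := hTf.toFinset
  have mU : ∀ x, x ∈ U ↔ x ∈ T := fun x => hTf.mem_toFinset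
  have e1 : ∀ (H : V → V → ℝ), (∀ x y, G.Adj x y → H x y ≠ 0 → x ∈ T ∧ y ∈ T) →
      ∑' x, ∑ y ∈ G.neighborFinset x, H x y = ∑ x ∈ U, ∑ y ∈ U, if G.Adj x y then H x y else 0 := by
    intro H hH
    rw [tsum_eq_sum (s := U)]
    · refine Finset.sum_congr rfl fun x _ => ?_
      rw [← Finset.sum_filter]
      symm
      refine Finset.sum_subset_zero_on_sdiff ?_ ?_ (fun _ _ => rfl)
      · intro y hy; simpa using (Finset.mem_filter.1 hy).2
      · intro y hy
        simp only [Finset.mem_sdiff, SimpleGraph.mem_neighborFinset, Finset.mem_filter, mU,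
          not_and] at hy
        by_contra h
        exact hy.2 (hH x y hy.1 h).2 hy.1
    · intro x hx
      refine Finset.sum_eq_zero fun y hy => ?_
      by_contra h
      exact hx ((mU x).2 (hH x y (by simpa using hy) h).1)
  rw [e1 F key, e1 (fun x y => F y x) fun x y h h' => (key y x h.symm h').symm, Finset.sum_comm]
  simp_rw [G.adj_comm]

theorem degree_mul_avg (g : V → ℝ) (x : V) :
    (G.degree x : ℝ) * avg G g x = ∑ y ∈ G.neighborFinset x, g y := by
  unfold avg
  rcases Nat.eq_zero_or_pos (G.degree x) with h | h
  · have : G.neighborFinset x = ∅ := by rw [← Finset.card_eq_zero]; exact h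
    simp [this]
  · have : (G.degree x : ℝ) ≠ 0 := by exact_mod_cast h.ne'
    field_simp

theorem ip_avg_eq (f g : V → ℝ) :
    ip G f (avg G g) = ∑' x, ∑ y ∈ G.neighborFinset x, f x * g y := by
  unfold ip
  congr 1; funext x
  rw [← Finset.mul_sum, ← degree_mul_avg]; ring

theorem ip_avg_comm {f g : V → ℝ} (hf : f.support.Finite) :
    ip G f (avg G g) = ip G (avg G f) g := by
  rw [ip_comm (avg G f), ip_avg_eq, ip_avg_eq, tsum_neighbor_symm hf]
  · simp_rw [mul_comm]
  · intro x y h; left; exact left_ne_zero_of_mul h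

theorem support_sum_finite {H : V → V → ℝ} {s : Set V} (hs : s.Finite)
    (hF : ∀ x y, H x y ≠ 0 → x ∈ s ∨ y ∈ s) :
    (Function.support fun x => ∑ y ∈ G.neighborFinset x, H x y).Finite := by
  refine (hs.union (hs.biUnion (t := fun z => (G.neighborFinset z : Set V))
    fun z _ => Finset.finite_toSet _)).subset fun x hx => ?_
  obtain ⟨y, hy, h⟩ : ∃ y ∈ G.neighborFinset x, H x y ≠ 0 := by
    by_contra! h
    exact hx (Finset.sum_eq_zero h)
  simp only [SimpleGraph.mem_neighborFinset] at hy
  rcases hF x y h with h | h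
  · exact Or.inl h
  · right; simp only [Set.mem_iUnion]
    exact ⟨y, h, by simpa using hy.symm⟩

theorem summable_sum_neighbor {H : V → V → ℝ} {s : Set V} (hs : s.Finite)
    (hF : ∀ x y, H x y ≠ 0 → x ∈ s ∨ y ∈ s) :
    Summable fun x => ∑ y ∈ G.neighborFinset x, H x y :=
  summable_of_ne_finset_zero (s := (support_sum_finite (G := G) hs hF).toFinset) fun x hx => by
    simpa using hx

/-- The Dirichlet form. -/
theorem tsum_sq_sub_eq {f : V → ℝ} (hf : f.support.Finite) :
    ∑' x, ∑ y ∈ G.neighborFinset x, (f x - f y) ^ 2 = 2 * (ip G f f - ip G f (avg G f)) := by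
  have h1 : ∀ x y, f x * f x ≠ 0 → x ∈ f.support ∨ y ∈ f.support :=
    fun x y h => Or.inl (left_ne_zero_of_mul h)
  have h2 : ∀ x y, f y * f y ≠ 0 → x ∈ f.support ∨ y ∈ f.support :=
    fun x y h => Or.inr (left_ne_zero_of_mul h)
  have h3 : ∀ x y, f x * f y ≠ 0 → x ∈ f.support ∨ y ∈ f.support :=
    fun x y h => Or.inl (left_ne_zero_of_mul h)
  have e1 : ∑' x, ∑ y ∈ G.neighborFinset x, f x * f x = ip G f f := by
    unfold ip; congr 1; funext x; simp
  have e2 : ∑' x, ∑ y ∈ G.neighborFinset x, f y * f y = ip G f f := by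
    rw [← e1]; exact (tsum_neighbor_symm hf h1).symm
  have s1 := summable_sum_neighbor (G := G) hf h1
  have s2 := summable_sum_neighbor (G := G) hf h2
  have s3 := summable_sum_neighbor (G := G) hf h3
  calc _ = ∑' x, ((∑ y ∈ G.neighborFinset x, f x * f x + ∑ y ∈ G.neighborFinset x, f y * f y)
        - 2 * ∑ y ∈ G.neighborFinset x, f x * f y) := by
        congr 1; funext x
        rw [Finset.mul_sum, ← Finset.sum_add_distrib, ← Finset.sum_sub_distrib]
        refine Finset.sum_congr rfl fun y _ => by ring
    _ = _ := by
        rw [(s1.add s2).tsum_sub (s3.mul_left 2), s1.tsum_add s2, tsum_mul_left, e1, e2, ip_avg_eq]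
        ring

theorem ip_avg_avg_le {f : V → ℝ} (hf : f.support.Finite) :
    ip G (avg G f) (avg G f) ≤ ip G f f := by
  have h2 : ∀ x y, f y * f y ≠ 0 → x ∈ f.support ∨ y ∈ f.support :=
    fun x y h => Or.inr (left_ne_zero_of_mul h)
  have e2 : ∑' x, ∑ y ∈ G.neighborFinset x, f y * f y = ip G f f := by
    rw [← tsum_neighbor_symm (F := fun x _ => f x * f x) hf
      fun x y h => Or.inl (left_ne_zero_of_mul h)]
    unfold ip; congr 1; funext x; simp
  rw [← e2]
  refine Summable.tsum_le_tsum (fun x => ?_) (summable_ip (support_avg_finite hf) _)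
    (summable_sum_neighbor hf h2)
  unfold avg
  rcases Nat.eq_zero_or_pos (G.degree x) with h | h
  · rw [h]; simp; exact Finset.sum_nonneg fun y _ => mul_self_nonneg _
  · have h0 : (0 : ℝ) < G.degree x := by exact_mod_cast h
    have := sq_sum_le_card_mul_sum_sq (s := G.neighborFinset x) (f := f)
    rw [SimpleGraph.card_neighborFinset_eq_degree] at this
    have e : (G.degree x : ℝ) * ((∑ z ∈ G.neighborFinset x, f z) / G.degree x *
        ((∑ z ∈ G.neighborFinset x, f z) / G.degree x)) =
        (∑ z ∈ G.neighborFinset x, f z) ^ 2 / G.degree x := by field_simp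
    rw [e, div_le_iff₀ h0, mul_comm]
    simpa only [← sq] using this

/-- Self-adjointness of `avg` moves all the averaging onto one factor; pairing with the time-zero
density is evaluation at `v`. This is the reversible form of Chapman–Kolmogorov. -/
theorem ip_dens_dens (hd : ∀ x, 0 < G.degree x) (a b : ℕ) (v w : V) :
    ip G (dens G a v) (dens G b w) = dens G (a + b) w v := by
  induction a generalizing b with
  | zero =>
    have h0 : (G.degree v : ℝ) ≠ 0 := by exact_mod_cast (hd v).ne'
    unfold ip
    rw [tsum_eq_single v]
    · simp [dens, pointMass]; field_simp
    · intro x hx; simp [dens, pointMass, hx]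
  | succ a ih =>
    rw [dens_succ, ← ip_avg_comm (support_dens_finite a v), ← dens_succ, ih]
    congr 1; ring

theorem dens_symm (hd : ∀ x, 0 < G.degree x) (n : ℕ) (v w : V) : dens G n v w = dens G n w v := by
  have h1 := ip_dens_dens hd n 0 v w
  have h2 := ip_dens_dens hd 0 n w v
  rw [ip_comm] at h1
  simp only [zero_add, add_zero] at h1 h2
  rw [← h1, ← h2]

theorem dens_le_heat (hd : ∀ x, 0 < G.degree x) (n : ℕ) (v x : V) :
    dens G n v x ≤ heat G n v x := by
  rw [dens_symm hd, dens_eq_heat_div]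
  exact div_le_self (heat_nonneg _ _ _) (by exact_mod_cast hd x)

theorem ip_sq_le {f g : V → ℝ} (hf : f.support.Finite) (hg : g.support.Finite) :
    ip G f g ^ 2 ≤ ip G f f * ip G g g := by
  have hfin : (f.support ∪ g.support).Finite := hf.union hg
  have e : ∀ a b : V → ℝ, a.support ⊆ f.support ∪ g.support →
      ip G a b = ∑ x ∈ hfin.toFinset, (G.degree x : ℝ) * (a x * b x) := by
    intro a b hab
    refine tsum_eq_sum fun x hx => ?_
    have : a x = 0 := by
      by_contra h
      exact hx (hfin.mem_toFinset.2 (hab h))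
    simp [this]
  rw [e f g Set.subset_union_left, e f f Set.subset_union_left, e g g Set.subset_union_right]
  have := Finset.sum_mul_sq_le_sq_mul_sq hfin.toFinset
    (fun x => √(G.degree x : ℝ) * f x) (fun x => √(G.degree x : ℝ) * g x)
  have e1 : ∀ a b : V → ℝ, ∀ x, (G.degree x : ℝ) * (a x * b x) =
      (√(G.degree x : ℝ) * a x) * (√(G.degree x : ℝ) * b x) := fun a b x => by
    have := Real.mul_self_sqrt (Nat.cast_nonneg (α := ℝ) (G.degree x))
    linear_combination (a x * b x) * (-this)
  simp only [e1]
  simpa only [← sq] using this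

/-- The on-diagonal density at time `2 n`. -/
theorem dens_two_mul_self (hd : ∀ x, 0 < G.degree x) (n : ℕ) (v : V) :
    dens G (2 * n) v v = ip G (dens G n v) (dens G n v) := by
  rw [ip_dens_dens hd, two_mul]

/-- This is the expansion of $\|p_n(v,\cdot) - p_{n+2}(v,\cdot)\|^2 \ge 0$. -/
theorem dens_two_mul_convex (hd : ∀ x, 0 < G.degree x) (n : ℕ) (v : V) :
    dens G (2 * (n + 1)) v v - dens G (2 * (n + 2)) v v ≤
      dens G (2 * n) v v - dens G (2 * (n + 1)) v v := by
  have h := ip_self_nonneg (G := G) (dens G n v - dens G (n + 2) v)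
  rw [ip_sub_sub (support_dens_finite _ _) (support_dens_finite _ _), ip_dens_dens hd,
    ip_dens_dens hd, ip_dens_dens hd] at h
  have e1 : n + n = 2 * n := by ring
  have e2 : n + (n + 2) = 2 * (n + 1) := by ring
  have e3 : n + 2 + (n + 2) = 2 * (n + 2) := by ring
  rw [e1, e2, e3] at h
  linarith

/-- By convexity the decrements of $\varphi(k) = p_{2k}(v,v)$ decrease, so the one at $2n$ is at
most the average of those at $n, \dots, 2n-1$, and these telescope to at most $\varphi(n)$. -/
theorem dens_decrement_le (hd : ∀ x, 0 < G.degree x) (n : ℕ) (v : V) :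
    n * (dens G (2 * (2 * n)) v v - dens G (2 * (2 * n + 1)) v v) ≤ dens G (2 * n) v v := by
  set φ : ℕ → ℝ := fun n => dens G (2 * n) v v with hφ
  have hanti : Antitone fun k => φ k - φ (k + 1) :=
    antitone_nat_of_succ_le fun k => dens_two_mul_convex hd k v
  have h1 : ∑ k ∈ Finset.range n, (φ (n + k) - φ (n + k + 1)) = φ n - φ (n + n) := by
    have := Finset.sum_range_sub' (fun k => φ (n + k)) n
    simpa [add_assoc] using this
  have h2 : (n : ℝ) * (φ (2 * n) - φ (2 * n + 1)) ≤
      ∑ k ∈ Finset.range n, (φ (n + k) - φ (n + k + 1)) := by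
    have := Finset.card_nsmul_le_sum (Finset.range n) (fun k => φ (n + k) - φ (n + k + 1))
      (φ (2 * n) - φ (2 * n + 1)) (fun k hk => hanti (by
        have := Finset.mem_range.1 hk; omega))
    simpa using this
  have h3 : 0 ≤ φ (n + n) := dens_nonneg _ _ _
  linarith

/-- Along a walk, the square of the increment of a function is controlled by the sum of its local
energies. -/
theorem sq_sub_le_length_mul {f : V → ℝ} {u v : V} (p : G.Walk u v) :
    (f u - f v) ^ 2 ≤
      p.length * (p.support.map fun x => ∑ y ∈ G.neighborFinset x, (f x - f y) ^ 2).sum := by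
  induction p with
  | nil => simp
  | @cons u w v h p ih =>
    simp only [SimpleGraph.Walk.length_cons, SimpleGraph.Walk.support_cons, List.map_cons,
      List.sum_cons]
    set s := (p.support.map fun x => ∑ y ∈ G.neighborFinset x, (f x - f y) ^ 2).sum
    set e := ∑ y ∈ G.neighborFinset u, (f u - f y) ^ 2
    have hs : 0 ≤ s := List.sum_nonneg (by
      intro a ha
      obtain ⟨x, -, rfl⟩ := List.mem_map.1 ha
      exact Finset.sum_nonneg fun y _ => sq_nonneg _)
    have he : (f u - f w) ^ 2 ≤ e :=
      Finset.single_le_sum (f := fun y => (f u - f y) ^ 2) (fun y _ => sq_nonneg _)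
        (by simpa using h)
    set n : ℝ := (p.length : ℝ)
    have hn : 0 ≤ n := Nat.cast_nonneg _
    have he0 : 0 ≤ e := (sq_nonneg _).trans he
    set a := f u - f w
    set b := f w - f v
    have hab : f u - f v = a + b := by simp [a, b]
    rw [hab]
    have h2 : 2 * (a * b) ≤ n * e + s := by
      refine le_of_abs_le (abs_le_of_sq_le_sq ?_ (by positivity))
      have : a ^ 2 * b ^ 2 ≤ e * (n * s) := mul_le_mul he ih (sq_nonneg _) he0
      nlinarith [sq_nonneg (n * e - s)]
    push_cast
    nlinarith

/-- A path visits each vertex at most once, so the local energies along it sum to at most the total.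
Passing to `bypass` reduces any walk to a path without lengthening it. The factor 2 comes from
`tsum_sq_sub_eq`, where each edge is counted in both directions. -/
theorem sq_sub_le_energy {f : V → ℝ} (hf : f.support.Finite) {u v : V} (p : G.Walk u v) {D : ℝ}
    (hD : p.length ≤ D) :
    (f u - f v) ^ 2 ≤ 2 * D * (ip G f f - ip G f (avg G f)) := by
  classical
  have h1 := sq_sub_le_length_mul (f := f) p.bypass
  have hnd : p.bypass.support.Nodup := p.bypass_isPath.support_nodup
  have hnn : ∀ x, 0 ≤ ∑ y ∈ G.neighborFinset x, (f x - f y) ^ 2 :=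
    fun x => Finset.sum_nonneg fun y _ => sq_nonneg _
  have hF : ∀ x y, (f x - f y) ^ 2 ≠ 0 → x ∈ f.support ∨ y ∈ f.support := by
    intro x y h
    by_contra! h'
    have h1 : f x = 0 := by simpa using h'.1
    have h2 : f y = 0 := by simpa using h'.2
    simp [h1, h2] at h
  have h2 : (p.bypass.support.map fun x => ∑ y ∈ G.neighborFinset x, (f x - f y) ^ 2).sum ≤
      ∑' x, ∑ y ∈ G.neighborFinset x, (f x - f y) ^ 2 := by
    rw [← List.sum_toFinset _ hnd]
    exact (summable_sum_neighbor hf hF).sum_le_tsum _ fun x _ => hnn x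
  rw [tsum_sq_sub_eq hf] at h2
  have h0 : 0 ≤ (p.bypass.support.map fun x => ∑ y ∈ G.neighborFinset x, (f x - f y) ^ 2).sum := by
    rw [← List.sum_toFinset _ hnd]
    exact Finset.sum_nonneg fun x _ => hnn x
  have hl : (p.bypass.length : ℝ) ≤ D := le_trans (by exact_mod_cast p.length_bypass_le_length) hD
  calc _ ≤ _ := h1
    _ ≤ D * (2 * (ip G f f - ip G f (avg G f))) := mul_le_mul hl h2 h0 (by
        exact le_trans (Nat.cast_nonneg _) hD)
    _ = _ := by ring

/-! ### Heat kernel bounds on bipartite graphs -/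

section Bipartite

variable {c : V → ℤ}

theorem heat_eq_zero_of_parity (hc : ∀ x y, G.Adj x y → (Even (c x) ↔ ¬ Even (c y))) (n : ℕ)
    (x w : V) (h : ¬ Even (c x + c w + n)) : heat G n x w = 0 := by
  induction n generalizing x with
  | zero =>
    have : x ≠ w := by
      rintro rfl
      apply h; simp
    simp [heat, pointMass, this]
  | succ n ih =>
    unfold heat
    rw [Function.iterate_succ_apply']
    unfold avg
    rw [Finset.sum_eq_zero, zero_div]
    intro z hz
    refine ih z fun h' => h ?_
    have := hc x z (by simpa using hz)
    push_cast
    simp only [Int.even_add, Int.even_coe_nat, Int.not_even_one] at *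
    tauto

theorem dens_odd_eq_zero (hc : ∀ x y, G.Adj x y → (Even (c x) ↔ ¬ Even (c y))) (n : ℕ)
    {v w : V} (h : Even (c v + c w)) : dens G (2 * n + 1) v w = 0 := by
  rw [dens_eq_heat_div, heat_eq_zero_of_parity hc, zero_div]
  push_cast
  rw [add_comm (c w)]
  simp only [Int.even_add, Int.even_coe_nat, Int.not_even_one, Int.even_mul] at *
  simp
  tauto

/-- A density at one time vanishes on half of the vertices and has large energy. Adding two
consecutive times removes this oscillation: return densities at odd times vanish, and the energy of
the sum collapses to $p_{4n}(v,v) - p_{4n+2}(v,v)$, a single decrement. -/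
theorem energy_dens_le (hd : ∀ x, 0 < G.degree x)
    (hc : ∀ x y, G.Adj x y → (Even (c x) ↔ ¬ Even (c y))) (n : ℕ) (v : V) :
    n * (ip G (dens G (2 * n) v + dens G (2 * n + 1) v) (dens G (2 * n) v + dens G (2 * n + 1) v)
      - ip G (dens G (2 * n) v + dens G (2 * n + 1) v)
        (avg G (dens G (2 * n) v + dens G (2 * n + 1) v))) ≤ dens G (2 * n) v v := by
  refine le_trans (le_of_eq ?_) (dens_decrement_le hd n v)
  rw [avg_add, ← dens_succ, ← dens_succ]
  have F := fun k => support_dens_finite (G := G) k v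
  have hvv : Even (c v + c v) := ⟨c v, rfl⟩
  have e1 : dens G (2 * n + (2 * n + 1)) v v = 0 := by
    rw [show 2 * n + (2 * n + 1) = 2 * (2 * n) + 1 by ring]; exact dens_odd_eq_zero hc _ hvv
  have e3 : dens G (2 * n + 1 + (2 * n + 1 + 1)) v v = 0 := by
    rw [show 2 * n + 1 + (2 * n + 1 + 1) = 2 * (2 * n + 1) + 1 by ring]
    exact dens_odd_eq_zero hc _ hvv
  simp only [ip_add_left (F _) (F _), ip_comm (dens G (2 * n) v) (dens G (2 * n) v + _),
    ip_comm (dens G (2 * n + 1) v) (dens G (2 * n) v + _),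
    ip_comm (dens G (2 * n) v) (dens G (2 * n + 1) v + _),
    ip_comm (dens G (2 * n + 1) v) (dens G (2 * n + 1) v + _)]
  simp only [ip_dens_dens hd]
  have e4 : dens G (2 * n + 1 + 2 * n) v v = 0 := by rw [add_comm, e1]
  have e5 : dens G (2 * n + 1 + 1 + (2 * n + 1)) v v = 0 := by rw [add_comm, e3]
  rw [show 2 * n + 1 + 1 + 2 * n = 2 * (2 * n + 1) by ring,
    show 2 * n + 2 * n = 2 * (2 * n) by ring,
    show 2 * n + 1 + (2 * n + 1) = 2 * (2 * n + 1) by ring, e1, e4, e5]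
  ring

theorem sq_sub_dens_le (hd : ∀ x, 0 < G.degree x)
    (hc : ∀ x y, G.Adj x y → (Even (c x) ↔ ¬ Even (c y))) {n : ℕ} (hn : 0 < n) {v w : V}
    (p : G.Walk v w) {D : ℝ} (hD : p.length ≤ D) :
    (dens G (2 * n) v v - (dens G (2 * n) v w + dens G (2 * n + 1) v w)) ^ 2 ≤
      2 * D / n * dens G (2 * n) v v := by
  have hvv : Even (c v + c v) := ⟨c v, rfl⟩
  have h1 := sq_sub_le_energy (support_add_finite (support_dens_finite (G := G) (2 * n) v)
    (support_dens_finite (G := G) (2 * n + 1) v)) p hD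
  have h2 := energy_dens_le (G := G) hd hc n v
  simp only [Pi.add_apply, dens_odd_eq_zero (G := G) hc n hvv, add_zero] at h1
  refine h1.trans ?_
  have hn' : (0 : ℝ) < n := by exact_mod_cast hn
  have hD0 : 0 ≤ D := le_trans (Nat.cast_nonneg _) hD
  rw [mul_comm (n : ℝ), ← le_div_iff₀ hn'] at h2
  calc _ ≤ 2 * D * (dens G (2 * n) v v / n) := mul_le_mul_of_nonneg_left h2 (by positivity)
    _ = _ := by ring

/-- On-diagonal heat kernel upper bound in terms of the volume of a set of vertices at bounded
distance. -/
theorem dens_diag_le (hd : ∀ x, 0 < G.degree x)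
    (hc : ∀ x y, G.Adj x y → (Even (c x) ↔ ¬ Even (c y))) {n : ℕ} (hn : 0 < n) (v : V)
    (B : Finset V) (hB : B.Nonempty) {D : ℝ}
    (hD : ∀ w ∈ B, ∃ p : G.Walk v w, (p.length : ℝ) ≤ D) :
    dens G (2 * n) v v ≤ 4 / B.card + 2 * D / n := by
  set f := fun w => dens G (2 * n) v w + dens G (2 * n + 1) v w with hf
  have hBc : (0 : ℝ) < B.card := by exact_mod_cast hB.card_pos
  have hsum : ∑ w ∈ B, f w ≤ 2 := by
    rw [hf, Finset.sum_add_distrib]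
    have h : ∀ k, ∑ w ∈ B, dens G k v w ≤ 1 := fun k =>
      (Finset.sum_le_sum fun w _ => dens_le_heat hd k v w).trans (sum_heat_le_one hd k v B)
    linarith [h (2 * n), h (2 * n + 1)]
  -- The two kernels have total mass at most 2, so some vertex of `B` carries at most the average.
  obtain ⟨w, hw, hfw⟩ : ∃ w ∈ B, f w ≤ 2 / B.card := by
    by_contra! h
    have := Finset.sum_lt_sum_of_nonempty hB h
    rw [Finset.sum_const, nsmul_eq_mul, mul_div_cancel₀ _ hBc.ne'] at this
    linarith
  obtain ⟨p, hp⟩ := hD w hw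
  have h := sq_sub_dens_le hd hc hn p hp
  have hn' : (0 : ℝ) < n := by exact_mod_cast hn
  have hD0 : 0 ≤ D := le_trans (Nat.cast_nonneg _) hp
  set φ := dens G (2 * n) v v
  have hφ : 0 ≤ φ := dens_nonneg _ _ _
  -- The energy bound gives $(\varphi - f(w))^2 \le (2D/n)\varphi$; the arithmetic–geometric mean
  -- inequality then lets half of $\varphi$ be absorbed on the left.
  have h' : φ - f w ≤ φ / 2 + D / n := by
    refine le_of_abs_le (abs_le_of_sq_le_sq (h.trans ?_) (by positivity))
    have : 2 * D / n * φ = 4 * (φ / 2) * (D / n) := by ring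
    rw [this]
    nlinarith [sq_nonneg (φ / 2 - D / n)]
  have e1 : 4 / (B.card : ℝ) = 2 * (2 / B.card) := by ring
  have e2 : 2 * D / n = 2 * (D / n) := by ring
  rw [e1, e2]; linarith

/-- Square-integrated difference of the densities started from two vertices of equal parity. -/
theorem ip_dens_sub_le (hd : ∀ x, 0 < G.degree x)
    (hc : ∀ x y, G.Adj x y → (Even (c x) ↔ ¬ Even (c y))) {n : ℕ} (hn : 0 < n) {v w : V}
    (hvw : Even (c v + c w)) (p : G.Walk v w) :
    ip G (dens G n v - dens G n w) (dens G n v - dens G n w) ≤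
      √(2 * p.length / n * dens G (2 * n) v v) + √(2 * p.length / n * dens G (2 * n) w w) := by
  rw [ip_sub_sub (support_dens_finite _ _) (support_dens_finite _ _), ip_dens_dens hd,
    ip_dens_dens hd, ip_dens_dens hd, ← two_mul]
  -- The squared norm splits as $[p_{2n}(v,v) - p_{2n}(v,w)] + [p_{2n}(w,w) - p_{2n}(v,w)]$, and
  -- each bracket is an increment along the walk. Equal parity makes the odd-time summand vanish.
  have h1 := sq_sub_dens_le hd hc hn p (D := p.length) le_rfl
  have h2 := sq_sub_dens_le hd hc hn p.reverse (D := p.length) (by simp)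
  rw [dens_odd_eq_zero hc n hvw, add_zero] at h1
  rw [dens_odd_eq_zero hc n (by rwa [add_comm]), add_zero] at h2
  have h3 := Real.le_sqrt_of_sq_le h1
  have h4 := Real.le_sqrt_of_sq_le h2
  rw [dens_symm hd (2 * n) v w] at h3
  linarith

theorem dens_even_sq_le (hd : ∀ x, 0 < G.degree x) (n : ℕ) (v w : V) :
    dens G (2 * n) v w ^ 2 ≤ dens G (2 * n) v v * dens G (2 * n) w w := by
  have := ip_sq_le (G := G) (support_dens_finite (G := G) n w) (support_dens_finite (G := G) n v)
  rw [ip_dens_dens hd, ip_dens_dens hd, ip_dens_dens hd, ← two_mul] at this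
  linarith

end Bipartite

end GraphHeatKernel

/-! ### Geometry of the comb and a Lyapunov function for the displacement -/

section CombGeometry

/-- The bound `(log (|t| ∨ 1)) ^ α` on the tooth at horizontal coordinate `t`. -/
noncomputable def ell (α t : ℝ) : ℝ := Real.log (max |t| 1) ^ α

/-- The height of the tooth at `a`. -/
noncomputable def hgt (α : ℝ) (a : ℤ) : ℤ := ⌊ell α a⌋

variable {α : ℝ}

theorem log_max_nonneg (t : ℝ) : 0 ≤ Real.log (max |t| 1) := Real.log_nonneg (le_max_right _ _)

theorem ell_nonneg (t : ℝ) : 0 ≤ ell α t := Real.rpow_nonneg (log_max_nonneg t) _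

theorem ell_neg (t : ℝ) : ell α (-t) = ell α t := by simp [ell]

theorem ell_mono (hα0 : 0 ≤ α) {s t : ℝ} (h : |s| ≤ |t|) : ell α s ≤ ell α t := by
  refine Real.rpow_le_rpow (log_max_nonneg s) (Real.log_le_log ?_ (max_le_max_right _ h)) hα0
  exact lt_of_lt_of_le one_pos (le_max_right _ _)

theorem rpow_le_max_one (hα0 : 0 ≤ α) (hα1 : α ≤ 1) {t : ℝ} (ht : 0 ≤ t) : t ^ α ≤ max 1 t := by
  rcases le_total t 1 with h | h
  · exact (Real.rpow_le_one ht h hα0).trans (le_max_left _ _)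
  · refine le_trans ?_ (le_max_right _ _)
    simpa using Real.rpow_le_rpow_of_exponent_le h hα1

theorem ell_le_max (hα0 : 0 ≤ α) (hα1 : α ≤ 1) (t : ℝ) :
    ell α t ≤ max 1 (Real.log (max |t| 1)) :=
  rpow_le_max_one hα0 hα1 (log_max_nonneg t)

theorem log_max_le (t : ℝ) : Real.log (max |t| 1) ≤ |t| / 2 := by
  rcases le_total |t| 1 with h | h
  · rw [max_eq_right h, Real.log_one]; positivity
  · rw [max_eq_left h]
    have h0 : 0 < |t| := by linarith
    have h1 := Real.add_one_le_exp (Real.log |t| - Real.log 2 - 0)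
    have := Real.log_le_sub_one_of_pos (show 0 < |t| / 2 by positivity)
    rw [Real.log_div h0.ne' two_ne_zero] at this
    have h3 := Real.log_two_lt_d9
    linarith

theorem hgt_nonneg (a : ℤ) : 0 ≤ hgt α a := Int.floor_nonneg.2 (ell_nonneg _)

theorem hgt_neg (a : ℤ) : hgt α (-a) = hgt α a := by simp [hgt, ell_neg]

theorem hgt_le_ell (a : ℤ) : (hgt α a : ℝ) ≤ ell α a := Int.floor_le _

theorem ell_lt_hgt (a : ℤ) : ell α a < hgt α a + 1 := Int.lt_floor_add_one _

theorem mem_combLogVertices {p : ℤ × ℤ} :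
    p ∈ combLogVertices α ↔ 0 ≤ p.2 ∧ p.2 ≤ hgt α p.1 := by
  rw [hgt, Int.le_floor]; rfl

theorem spine_mem (a : ℤ) : (a, (0 : ℤ)) ∈ combLogVertices α :=
  mem_combLogVertices.2 ⟨le_rfl, hgt_nonneg a⟩

theorem vertex_nonneg (v : combLogVertices α) : 0 ≤ v.1.2 := v.2.1

theorem vertex_le_hgt (v : combLogVertices α) : v.1.2 ≤ hgt α v.1.1 :=
  (mem_combLogVertices.1 v.2).2

theorem combLog_adj {v w : combLogVertices α} : (combLog α).Adj v w ↔
    (v.1.1 = w.1.1 ∧ |v.1.2 - w.1.2| = 1) ∨ (v.1.2 = 0 ∧ w.1.2 = 0 ∧ |v.1.1 - w.1.1| = 1) :=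
  Iff.rfl

theorem sum_neighborFinset (v : combLogVertices α) (g : ℤ × ℤ → ℝ) (s : Finset (ℤ × ℤ))
    (hs : ∀ p, p ∈ s ↔ (0 ≤ p.2 ∧ p.2 ≤ hgt α p.1) ∧
      ((v.1.1 = p.1 ∧ |v.1.2 - p.2| = 1) ∨ (v.1.2 = 0 ∧ p.2 = 0 ∧ |v.1.1 - p.1| = 1))) :
    ∑ z ∈ (combLog α).neighborFinset v, g z.1 = ∑ p ∈ s, g p := by
  have : s = ((combLog α).neighborFinset v).map ⟨Subtype.val, Subtype.val_injective⟩ := by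
    ext p
    rw [hs, ← mem_combLogVertices]
    simp only [Finset.mem_map, SimpleGraph.mem_neighborFinset, Function.Embedding.coeFn_mk]
    constructor
    · rintro ⟨h1, h2⟩; exact ⟨⟨p, h1⟩, h2, rfl⟩
    · rintro ⟨z, h, rfl⟩; exact ⟨z.2, h⟩
  rw [this, Finset.sum_map]; rfl

theorem sum_neighbor_spine_zero (v : combLogVertices α) (g : ℤ × ℤ → ℝ) (h0 : v.1.2 = 0)
    (h : hgt α v.1.1 = 0) : ∑ z ∈ (combLog α).neighborFinset v, g z.1 =
      g (v.1.1 + 1, 0) + g (v.1.1 - 1, 0) := by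
  rw [sum_neighborFinset v g {(v.1.1 + 1, 0), (v.1.1 - 1, 0)}, Finset.sum_pair]
  · simp; omega
  · rintro ⟨p, q⟩
    simp only [Finset.mem_insert, Finset.mem_singleton, Prod.mk.injEq, h0, abs_eq zero_le_one]
    constructor
    · rintro (⟨rfl, rfl⟩ | ⟨rfl, rfl⟩)
      · exact ⟨⟨le_rfl, hgt_nonneg _⟩, by simp⟩
      · exact ⟨⟨le_rfl, hgt_nonneg _⟩, by simp⟩
    · rintro ⟨⟨h1, h2⟩, (⟨rfl, h3⟩ | h3)⟩ <;> omega

theorem sum_neighbor_spine_pos (v : combLogVertices α) (g : ℤ × ℤ → ℝ) (h0 : v.1.2 = 0)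
    (h : 0 < hgt α v.1.1) : ∑ z ∈ (combLog α).neighborFinset v, g z.1 =
      g (v.1.1 + 1, 0) + g (v.1.1 - 1, 0) + g (v.1.1, 1) := by
  rw [sum_neighborFinset v g {(v.1.1 + 1, 0), (v.1.1 - 1, 0), (v.1.1, 1)}, Finset.sum_insert,
    Finset.sum_pair, add_assoc]
  · simp
  · simp; omega
  · rintro ⟨p, q⟩
    simp only [Finset.mem_insert, Finset.mem_singleton, Prod.mk.injEq, h0, abs_eq zero_le_one]
    constructor
    · rintro (⟨rfl, rfl⟩ | ⟨rfl, rfl⟩ | ⟨rfl, rfl⟩)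
      · exact ⟨⟨le_rfl, hgt_nonneg _⟩, by simp⟩
      · exact ⟨⟨le_rfl, hgt_nonneg _⟩, by simp⟩
      · exact ⟨by omega, by omega⟩
    · rintro ⟨⟨h1, h2⟩, (⟨rfl, h3⟩ | h3)⟩ <;> omega

theorem sum_neighbor_tooth_top (v : combLogVertices α) (g : ℤ × ℤ → ℝ) (h0 : v.1.2 ≠ 0)
    (h : v.1.2 = hgt α v.1.1) : ∑ z ∈ (combLog α).neighborFinset v, g z.1 =
      g (v.1.1, v.1.2 - 1) := by
  have hv := vertex_nonneg v
  rw [sum_neighborFinset v g {(v.1.1, v.1.2 - 1)}, Finset.sum_singleton]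
  rintro ⟨p, q⟩
  simp only [Finset.mem_singleton, Prod.mk.injEq, abs_eq zero_le_one]
  constructor
  · rintro ⟨rfl, rfl⟩; omega
  · rintro ⟨⟨h1, h2⟩, (⟨rfl, h3⟩ | h3)⟩ <;> omega

theorem sum_neighbor_tooth_mid (v : combLogVertices α) (g : ℤ × ℤ → ℝ) (h0 : v.1.2 ≠ 0)
    (h : v.1.2 < hgt α v.1.1) : ∑ z ∈ (combLog α).neighborFinset v, g z.1 =
      g (v.1.1, v.1.2 - 1) + g (v.1.1, v.1.2 + 1) := by
  have hv := vertex_nonneg v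
  rw [sum_neighborFinset v g {(v.1.1, v.1.2 - 1), (v.1.1, v.1.2 + 1)}, Finset.sum_pair]
  · simp; omega
  · rintro ⟨p, q⟩
    simp only [Finset.mem_insert, Finset.mem_singleton, Prod.mk.injEq, abs_eq zero_le_one]
    constructor
    · rintro (⟨rfl, rfl⟩ | ⟨rfl, rfl⟩) <;> omega
    · rintro ⟨⟨h1, h2⟩, (⟨rfl, h3⟩ | h3)⟩ <;> omega

theorem degree_eq_sum (v : combLogVertices α) :
    ((combLog α).degree v : ℝ) = ∑ z ∈ (combLog α).neighborFinset v, (fun _ => 1) z.1 := by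
  simp

theorem degree_pos_le (v : combLogVertices α) :
    0 < ((combLog α).degree v : ℝ) ∧ ((combLog α).degree v : ℝ) ≤ 3 := by
  rw [degree_eq_sum]
  by_cases h0 : v.1.2 = 0
  · rcases (hgt_nonneg (α := α) v.1.1).eq_or_lt with h | h
    · rw [sum_neighbor_spine_zero v (fun _ => 1) h0 h.symm]; norm_num
    · rw [sum_neighbor_spine_pos v (fun _ => 1) h0 h]; norm_num
  · rcases (vertex_le_hgt v).eq_or_lt with h | h
    · rw [sum_neighbor_tooth_top v (fun _ => 1) h0 h]; norm_num
    · rw [sum_neighbor_tooth_mid v (fun _ => 1) h0 h]; norm_num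

theorem combLog_degree_pos (v : combLogVertices α) : 0 < (combLog α).degree v := by
  exact_mod_cast (degree_pos_le v).1

/-- The two-colouring of the comb. -/
def combParity (v : combLogVertices α) : ℤ := v.1.1 + v.1.2

theorem combParity_adj (v w : combLogVertices α) (h : (combLog α).Adj v w) :
    Even (combParity v) ↔ ¬ Even (combParity w) := by
  rw [combLog_adj, abs_eq zero_le_one, abs_eq zero_le_one] at h
  unfold combParity
  rw [Int.even_iff, Int.even_iff]
  omega

/-- Vertical walks. -/
theorem exists_walk_tooth (a y : ℤ) (k : ℕ) (hy : 0 ≤ y) (h : y + k ≤ hgt α a)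
    (hv : (a, y + k) ∈ combLogVertices α) (hw : (a, y) ∈ combLogVertices α) :
    ∃ p : (combLog α).Walk ⟨(a, y + k), hv⟩ ⟨(a, y), hw⟩, p.length = k := by
  induction k with
  | zero =>
    have : (⟨(a, y + (0 : ℕ)), hv⟩ : combLogVertices α) = ⟨(a, y), hw⟩ := by simp
    rw [this]; exact ⟨.nil, rfl⟩
  | succ k ih =>
    have hu : (a, y + k) ∈ combLogVertices α :=
      mem_combLogVertices.2 ⟨by positivity, by push_cast at h ⊢; omega⟩
    obtain ⟨p, hp⟩ := ih (by push_cast at h; omega) hu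
    have hadj : (combLog α).Adj ⟨(a, y + (k + 1 : ℕ)), hv⟩ ⟨(a, y + k), hu⟩ := by
      rw [combLog_adj]; left; simp
    exact ⟨.cons hadj p, by simp [hp]⟩

/-- Horizontal walks. -/
theorem exists_walk_spine (a s : ℤ) (hs : |s| = 1) (k : ℕ) :
    ∃ p : (combLog α).Walk ⟨(a, 0), spine_mem a⟩ ⟨(a + s * k, 0), spine_mem _⟩, p.length = k := by
  induction k generalizing a with
  | zero =>
    have : (⟨(a + s * (0 : ℕ), 0), spine_mem _⟩ : combLogVertices α) = ⟨(a, 0), spine_mem a⟩ := by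
      simp
    rw [this]; exact ⟨.nil, rfl⟩
  | succ k ih =>
    have : (⟨(a + s * (k + 1 : ℕ), 0), spine_mem _⟩ : combLogVertices α) =
      ⟨(a + s + s * k, 0), spine_mem _⟩ := by
      simp; ring
    rw [this]
    obtain ⟨p, hp⟩ := ih (a + s)
    have hadj : (combLog α).Adj ⟨(a, 0), spine_mem a⟩ ⟨(a + s, 0), spine_mem _⟩ := by
      rw [combLog_adj]; right; simp [hs]
    exact ⟨.cons hadj p, by simp [hp]⟩

theorem exists_walk_to_spine (v : combLogVertices α) :
    ∃ p : (combLog α).Walk v ⟨(v.1.1, 0), spine_mem _⟩, (p.length : ℤ) = v.1.2 := by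
  obtain ⟨k, hk⟩ := Int.eq_ofNat_of_zero_le (vertex_nonneg v)
  have hle := vertex_le_hgt v
  have hv : (v.1.1, 0 + (k : ℤ)) ∈ combLogVertices α := by
    rw [zero_add, ← hk]; exact v.2
  have e := exists_walk_tooth v.1.1 0 k le_rfl (by omega) hv (spine_mem _)
  have : (⟨(v.1.1, 0 + (k : ℤ)), hv⟩ : combLogVertices α) = v := by
    ext <;> simp [hk]
  rw [this] at e
  obtain ⟨p, hp⟩ := e
  exact ⟨p, by rw [hp, hk]⟩

theorem exists_walk_of_spine (v w : combLogVertices α) (s : ℤ) (hs : |s| = 1) (k : ℕ)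
    (h : w.1.1 = v.1.1 + s * k) :
    ∃ p : (combLog α).Walk v w, (p.length : ℤ) = v.1.2 + k + w.1.2 := by
  obtain ⟨p, hp⟩ := exists_walk_to_spine v
  obtain ⟨q, hq⟩ := exists_walk_to_spine w
  have e := exists_walk_spine (α := α) v.1.1 s hs k
  have : (⟨(v.1.1 + s * k, 0), spine_mem _⟩ : combLogVertices α) = ⟨(w.1.1, 0), spine_mem _⟩ := by
    simp [h]
  rw [this] at e
  obtain ⟨r, hr⟩ := e
  refine ⟨(p.append r).append q.reverse, ?_⟩
  simp [hr, hp, hq]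

theorem combLog_exists_walk (v w : combLogVertices α) : Nonempty ((combLog α).Walk v w) := by
  rcases le_total v.1.1 w.1.1 with h | h
  · obtain ⟨p, -⟩ := exists_walk_of_spine v w 1 (by simp) (w.1.1 - v.1.1).toNat (by omega)
    exact ⟨p⟩
  · obtain ⟨p, -⟩ := exists_walk_of_spine v w (-1) (by simp) (v.1.1 - w.1.1).toNat (by omega)
    exact ⟨p⟩

/-- The horizontal part of the Lyapunov function: a discrete second antiderivative of the tooth
heights. -/
noncomputable def lyapF (α : ℝ) (k : ℕ) : ℝ :=
  ∑ i ∈ Finset.range k, ∑ j ∈ Finset.range (i + 1), ((hgt α j : ℝ) + 1)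

/-- A function of the position whose expectation grows at most linearly along the walk. -/
noncomputable def lyapG (α : ℝ) (p : ℤ × ℤ) : ℝ :=
  lyapF α p.1.natAbs - (2 * hgt α p.1 * p.2 - (p.2 : ℝ) ^ 2)

/-- Away from the origin the second difference is exactly half of this bound. The factor 2 is needed
only at 0, where reflecting `lyapF` to negative coordinates creates a kink. -/
theorem lyapF_second_diff (a : ℤ) :
    lyapF α (a + 1).natAbs + lyapF α (a - 1).natAbs - 2 * lyapF α a.natAbs ≤ 2 * hgt α a + 2 := by
  have key : ∀ n : ℕ, lyapF α (n + 1 : ℤ).natAbs + lyapF α (n - 1 : ℤ).natAbs -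
      2 * lyapF α (n : ℤ).natAbs ≤ 2 * hgt α n + 2 := by
    intro n
    have hh : (0 : ℝ) ≤ hgt α n := by exact_mod_cast hgt_nonneg _
    cases n with
    | zero => simp [lyapF]; linarith
    | succ n =>
      have e1 : ((n + 1 : ℕ) + 1 : ℤ).natAbs = n + 2 := by omega
      have e2 : ((n + 1 : ℕ) - 1 : ℤ).natAbs = n := by omega
      have e3 : ((n + 1 : ℕ) : ℤ).natAbs = n + 1 := by omega
      rw [e1, e2, e3]
      unfold lyapF
      rw [Finset.sum_range_succ _ (n + 1), Finset.sum_range_succ _ n,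
        Finset.sum_range_succ _ (n + 1)]
      linarith
  obtain ⟨n, rfl | rfl⟩ := a.eq_nat_or_neg
  · exact key n
  · have := key n
    rw [hgt_neg]
    have e1 : (-(n : ℤ) + 1).natAbs = (n - 1 : ℤ).natAbs := by omega
    have e2 : (-(n : ℤ) - 1).natAbs = (n + 1 : ℤ).natAbs := by omega
    have e3 : (-(n : ℤ)).natAbs = (n : ℤ).natAbs := by omega
    rw [e1, e2, e3]; linarith

/-- Along a tooth the parabola $-(2hx - x^2)$ has drift exactly 1, also at the top, about which it
is symmetric. At the foot of a tooth of positive height, the step into the tooth contributes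
$-(2h-1)$, which offsets the $2h+2$ from the second difference of `lyapF` and leaves 3, the degree.
-/
theorem avg_lyapG_le (v : combLogVertices α) :
    avg (combLog α) (fun z => lyapG α z.1) v ≤ lyapG α v.1 + 1 := by
  unfold avg
  rw [div_le_iff₀ (degree_pos_le v).1, degree_eq_sum]
  have hF := lyapF_second_diff (α := α) v.1.1
  by_cases h0 : v.1.2 = 0
  · rcases (hgt_nonneg (α := α) v.1.1).eq_or_lt with h | h
    · rw [sum_neighbor_spine_zero v (lyapG α) h0 h.symm, sum_neighbor_spine_zero v (fun _ => 1) h0 h.symm]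
      rw [← h] at hF
      simp only [lyapG, h0]
      push_cast at hF ⊢; linarith
    · rw [sum_neighbor_spine_pos v (lyapG α) h0 h, sum_neighbor_spine_pos v (fun _ => 1) h0 h]
      simp only [lyapG, h0]
      push_cast at hF ⊢; linarith
  · rcases (vertex_le_hgt v).eq_or_lt with h | h
    · rw [sum_neighbor_tooth_top v (lyapG α) h0 h, sum_neighbor_tooth_top v (fun _ => 1) h0 h]
      simp only [lyapG]
      rw [← h]; push_cast; linarith
    · rw [sum_neighbor_tooth_mid v (lyapG α) h0 h, sum_neighbor_tooth_mid v (fun _ => 1) h0 h]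
      simp only [lyapG]; push_cast; linarith

theorem avg_iter_lyapG_le (n : ℕ) (v : combLogVertices α) :
    (avg (combLog α))^[n] (fun z => lyapG α z.1) v ≤ lyapG α v.1 + n := by
  induction n generalizing v with
  | zero => simp
  | succ n ih =>
    rw [Function.iterate_succ_apply]
    have h1 := avg_iter_mono (G := combLog α) (g := (fun z => lyapG α z.1) + fun _ => 1)
      (fun v => avg_lyapG_le v) n v
    rw [avg_iter_add, avg_iter_const combLog_degree_pos] at h1
    have := ih v
    simp only [Pi.add_apply] at h1
    push_cast; linarith

theorem lyapF_mono : Monotone (lyapF α) := by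
  refine monotone_nat_of_le_succ fun k => ?_
  unfold lyapF
  rw [Finset.sum_range_succ]
  have : 0 ≤ ∑ j ∈ Finset.range (k + 1), ((hgt α j : ℝ) + 1) :=
    Finset.sum_nonneg fun j _ => by
      have : (0 : ℝ) ≤ hgt α j := by exact_mod_cast hgt_nonneg _
      linarith
  linarith

theorem lyapF_ge_sq (k : ℕ) : (k : ℝ) ^ 2 / 2 ≤ lyapF α k := by
  induction k with
  | zero => simp [lyapF]
  | succ k ih =>
    unfold lyapF at ih ⊢
    rw [Finset.sum_range_succ]
    have : ((k : ℝ) + 1) ≤ ∑ j ∈ Finset.range (k + 1), ((hgt α j : ℝ) + 1) := by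
      have := Finset.card_nsmul_le_sum (Finset.range (k + 1)) (fun j : ℕ => (hgt α j : ℝ) + 1) 1
        (fun j _ => by
          have : (0 : ℝ) ≤ hgt α j := by exact_mod_cast hgt_nonneg _
          linarith)
      simpa using this
    push_cast; linarith

theorem hgt_sq_le (hα0 : 0 ≤ α) (hα1 : α ≤ 1) (a : ℤ) :
    (hgt α a : ℝ) ^ 2 ≤ lyapF α a.natAbs / 2 + 1 := by
  have h1 := (hgt_le_ell (α := α) a).trans (ell_le_max hα0 hα1 a)
  have h2 := log_max_le (a : ℝ)
  have h3 := lyapF_ge_sq (α := α) a.natAbs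
  have h0 : (0 : ℝ) ≤ hgt α a := by exact_mod_cast hgt_nonneg _
  have e : ((a.natAbs : ℕ) : ℝ) = |(a : ℝ)| := by
    rw [Nat.cast_natAbs, Int.cast_abs]
  rw [e] at h3
  rcases le_max_iff.1 h1 with h | h
  · nlinarith [abs_nonneg (a : ℝ)]
  · nlinarith [abs_nonneg (a : ℝ)]

/-- The parabola is at most $h^2$. As $h$ is logarithmic while `lyapF` grows at least quadratically,
this uses up at most half of `lyapF`, up to a constant. -/
theorem lyapG_ge (hα0 : 0 ≤ α) (hα1 : α ≤ 1) (p : ℤ × ℤ) :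
    lyapF α p.1.natAbs / 2 - 1 ≤ lyapG α p := by
  have := hgt_sq_le hα0 hα1 p.1
  unfold lyapG
  nlinarith [sq_nonneg ((hgt α p.1 : ℝ) - p.2)]

/-- Only the terms with $2r \le i < 3r$ and $r \le j < 2r$ are kept, where each tooth satisfies $h_j
+ 1 \ge \ell(r)$. -/
theorem lyapF_ge_ell (hα0 : 0 ≤ α) (r : ℕ) : (r : ℝ) ^ 2 * ell α r ≤ lyapF α (3 * r) := by
  have hnn : ∀ j : ℕ, 0 ≤ (hgt α j : ℝ) + 1 := fun j => by
    have : (0 : ℝ) ≤ hgt α j := by exact_mod_cast hgt_nonneg _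
    linarith
  unfold lyapF
  have h1 : ∀ i ∈ Finset.Ico (2 * r) (3 * r),
      (r : ℝ) * ell α r ≤ ∑ j ∈ Finset.range (i + 1), ((hgt α j : ℝ) + 1) := by
    intro i hi
    rw [Finset.mem_Ico] at hi
    calc (r : ℝ) * ell α r = ∑ j ∈ Finset.Ico r (2 * r), ell α r := by
          simp; left; omega
      _ ≤ ∑ j ∈ Finset.Ico r (2 * r), ((hgt α j : ℝ) + 1) := by
          refine Finset.sum_le_sum fun j hj => ?_
          rw [Finset.mem_Ico] at hj
          refine le_trans (ell_mono hα0 ?_) (ell_lt_hgt (α := α) (j : ℤ)).le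
          simp; exact hj.1
      _ ≤ _ := by
          refine Finset.sum_le_sum_of_subset_of_nonneg ?_ (fun j _ _ => hnn j)
          intro j hj; simp at hj ⊢; omega
  calc (r : ℝ) ^ 2 * ell α r = ∑ i ∈ Finset.Ico (2 * r) (3 * r), (r : ℝ) * ell α r := by
        simp
        rw [show 3 * r - 2 * r = r by omega]; ring
    _ ≤ ∑ i ∈ Finset.Ico (2 * r) (3 * r), ∑ j ∈ Finset.range (i + 1), ((hgt α j : ℝ) + 1) :=
        Finset.sum_le_sum h1
    _ ≤ _ := by
        refine Finset.sum_le_sum_of_subset_of_nonneg ?_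
          (fun i _ _ => Finset.sum_nonneg fun j _ => hnn j)
        intro i hi; simp at hi ⊢; omega

theorem box_finite (hα0 : 0 ≤ α) (L : ℕ) : {v : combLogVertices α | |v.1.1| ≤ L}.Finite := by
  refine Set.Finite.of_finite_image (f := Subtype.val) ?_ Subtype.val_injective.injOn
  refine ((Finset.Icc (-(L : ℤ)) L ×ˢ Finset.Icc 0 (hgt α L)).finite_toSet).subset ?_
  rintro _ ⟨v, hv, rfl⟩
  have hv' : |v.1.1| ≤ L := hv
  have h1 := vertex_nonneg v
  have h2 := vertex_le_hgt v
  have h3 : hgt α v.1.1 ≤ hgt α L := Int.floor_mono (ell_mono hα0 (by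
    rw [← Int.cast_abs]; push_cast; rw [Nat.abs_cast]; exact_mod_cast hv'))
  simp only [Finset.coe_product, Finset.coe_Icc, Set.mem_prod, Set.mem_Icc]
  rw [abs_le] at hv'
  omega

open Classical in
/-- The vertices with horizontal coordinate at most `L` in absolute value. -/
noncomputable def box (α : ℝ) (L : ℕ) : Finset (combLogVertices α) :=
  if h : {v : combLogVertices α | |v.1.1| ≤ L}.Finite then h.toFinset else ∅

theorem mem_box (hα0 : 0 ≤ α) {L : ℕ} {v : combLogVertices α} : v ∈ box α L ↔ |v.1.1| ≤ L := by
  rw [box, dif_pos (box_finite hα0 L)]; simp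

theorem card_box_le (hα0 : 0 ≤ α) (L : ℕ) : ((box α L).card : ℝ) ≤ (2 * L + 1) * (ell α L + 1) := by
  have : (box α L).card ≤ (Finset.Icc (-(L : ℤ)) L ×ˢ Finset.Icc 0 (hgt α L)).card := by
    refine Finset.card_le_card_of_injOn Subtype.val ?_ Subtype.val_injective.injOn
    intro v hv
    have hv' : |v.1.1| ≤ L := (mem_box hα0).1 hv
    have h1 := vertex_nonneg v
    have h2 := vertex_le_hgt v
    have h3 : hgt α v.1.1 ≤ hgt α L := Int.floor_mono (ell_mono hα0 (by
      rw [← Int.cast_abs]; push_cast; rw [Nat.abs_cast]; exact_mod_cast hv'))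
    simp only [Finset.coe_product, Finset.coe_Icc, Set.mem_prod, Set.mem_Icc]
    rw [abs_le] at hv'
    omega
  rw [Finset.card_product, Int.card_Icc, Int.card_Icc] at this
  have h0 := hgt_nonneg (α := α) L
  have e : (((L + 1 - -(L : ℤ)).toNat * (hgt α L + 1 - 0).toNat : ℕ) : ℝ) =
      (2 * L + 1) * (hgt α L + 1) := by
    have : (((L + 1 - -(L : ℤ)).toNat * (hgt α L + 1 - 0).toNat : ℕ) : ℤ) =
        (2 * L + 1) * (hgt α L + 1) := by
      push_cast
      rw [Int.toNat_of_nonneg (by omega), Int.toNat_of_nonneg (by omega)]; ring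
    exact_mod_cast this
  have h2 := hgt_le_ell (α := α) L
  calc ((box α L).card : ℝ) ≤ (((L + 1 - -(L : ℤ)).toNat * (hgt α L + 1 - 0).toNat : ℕ) : ℝ) := by
        exact_mod_cast this
    _ = (2 * L + 1) * (hgt α L + 1) := e
    _ ≤ _ := by gcongr; simpa using h2

/-- The walk is in the box with large probability. -/
theorem sum_heat_box_ge (hα0 : 0 ≤ α) (hα1 : α ≤ 1) (n L : ℕ) (hL : 0 < L)
    (x : combLogVertices α) :
    1 - 2 * (lyapG α x.1 + n + 1) / lyapF α L ≤ ∑ w ∈ box α L, heat (combLog α) n x w := by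
  classical
  have hF : 0 < lyapF α L := by
    refine lt_of_lt_of_le ?_ (lyapF_ge_sq L)
    have : (0 : ℝ) < L := by exact_mod_cast hL
    positivity
  -- Markov's inequality in pointwise form: the Lyapunov function dominates the constant 1 outside
  -- the box. Applying the averaging operator `n` times gives the bound.
  have hpt : ∀ v : combLogVertices α, (fun _ => (1 : ℝ)) v ≤
      ((∑ w ∈ box α L, pointMass w) +
        (2 / lyapF α L) • ((fun z : combLogVertices α => lyapG α z.1) + fun _ => (1 : ℝ)) :
          combLogVertices α → ℝ) v := by
    intro v
    simp only [Pi.add_apply, Pi.smul_apply, smul_eq_mul]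
    rw [sum_pointMass]
    have h1 := lyapG_ge hα0 hα1 v.1
    have h2 : 0 ≤ lyapF α v.1.1.natAbs := le_trans (by positivity) (lyapF_ge_sq _)
    split_ifs with h
    · have : 0 ≤ 2 / lyapF α L * (lyapG α v.1 + 1) := by
        apply mul_nonneg (by positivity); linarith
      linarith
    · rw [mem_box hα0, Int.abs_eq_natAbs] at h
      have h3 : lyapF α L ≤ lyapF α v.1.1.natAbs := lyapF_mono (by omega)
      rw [zero_add, div_mul_eq_mul_div, le_div_iff₀ hF]
      linarith
  have h := avg_iter_mono (G := combLog α) hpt n x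
  rw [avg_iter_const combLog_degree_pos, avg_iter_add, avg_iter_smul, avg_iter_add,
    avg_iter_const combLog_degree_pos] at h
  simp only [Pi.add_apply, Pi.smul_apply, smul_eq_mul] at h
  rw [← sum_heat] at h
  have h4 := avg_iter_lyapG_le n x
  have h5 : 2 / lyapF α L * ((avg (combLog α))^[n] (fun z => lyapG α z.1) x + 1) ≤
      2 * (lyapG α x.1 + n + 1) / lyapF α L := by
    rw [div_mul_eq_mul_div]
    gcongr
  linarith

end CombGeometry

/-! ### Scales, and sums of $1/(j\,(\log j)^\alpha)$ -/

section LogSums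

variable {α : ℝ}

theorem one_lt_log_of_three_le {t : ℝ} (ht : 3 ≤ t) : 1 < Real.log t := by
  rw [Real.lt_log_iff_exp_lt (by linarith)]
  linarith [Real.exp_one_lt_d9]

theorem ell_eq {t : ℝ} (ht : 1 ≤ t) : ell α t = Real.log t ^ α := by
  rw [ell, abs_of_nonneg (by linarith), max_eq_left ht]

theorem one_le_ell (hα0 : 0 ≤ α) {t : ℝ} (ht : 3 ≤ t) : 1 ≤ ell α t := by
  rw [ell_eq (by linarith)]
  exact Real.one_le_rpow (one_lt_log_of_three_le ht).le hα0

theorem ell_le_log (hα1 : α ≤ 1) {t : ℝ} (ht : 3 ≤ t) : ell α t ≤ Real.log t := by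
  rw [ell_eq (by linarith)]
  simpa using Real.rpow_le_rpow_of_exponent_le (one_lt_log_of_three_le ht).le hα1

/-- `ell` varies slowly: comparing arguments whose logarithms are comparable. -/
theorem ell_le_mul (hα0 : 0 ≤ α) (hα1 : α ≤ 1) {s t : ℝ} {k : ℕ} (hk : 1 ≤ k) (hs : 1 ≤ s)
    (ht : 1 ≤ t) (h : t ≤ s ^ k) : ell α t ≤ k * ell α s := by
  have hk' : (1 : ℝ) ≤ k := by exact_mod_cast hk
  rw [ell_eq hs, ell_eq ht]
  have h1 : Real.log t ≤ k * Real.log s := by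
    rw [← Real.log_pow]; exact Real.log_le_log (by linarith) h
  calc Real.log t ^ α ≤ (k * Real.log s) ^ α := Real.rpow_le_rpow (Real.log_nonneg ht) h1 hα0
    _ = (k : ℝ) ^ α * Real.log s ^ α := Real.mul_rpow (by linarith) (Real.log_nonneg hs)
    _ ≤ k * Real.log s ^ α := by
        gcongr
        · exact Real.rpow_nonneg (Real.log_nonneg hs) _
        · simpa using Real.rpow_le_rpow_of_exponent_le hk' hα1

/-- The typical horizontal displacement of the walk by time `n`, up to constants. -/
noncomputable def rad (α : ℝ) (n : ℕ) : ℕ := ⌈8 * √(n / ell α n)⌉₊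

/-- The first two bounds say $r^2\ell(n) \asymp n$. The crude bound $n \le r^4$ makes $\log n$ and
$\log r$ comparable, so that $\ell$ may be evaluated at either scale. -/
theorem rad_estimates (hα0 : 0 ≤ α) (hα1 : α ≤ 1) {n : ℕ} (hn : 3 ≤ n) :
    64 * n ≤ (rad α n : ℝ) ^ 2 * ell α n ∧ (rad α n : ℝ) ^ 2 * ell α n ≤ 81 * n ∧
      (n : ℝ) ≤ (rad α n : ℝ) ^ 4 ∧ 1 ≤ rad α n := by
  have hn' : (3 : ℝ) ≤ n := by exact_mod_cast hn
  have h1 := one_le_ell hα0 hn'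
  have h2 := ell_le_log hα1 hn'
  have h3 : Real.log n ≤ 2 * √n := by
    have := Real.log_le_sub_one_of_pos (show 0 < √(n : ℝ) by positivity)
    rw [Real.log_sqrt (by positivity)] at this
    linarith
  have h4 : Real.log n ≤ n := (Real.log_le_sub_one_of_pos (by linarith)).trans (by linarith)
  have hl0 : 0 < ell α n := by linarith
  set s := √((n : ℝ) / ell α n) with hs
  have hs2 : s ^ 2 * ell α n = n := by
    rw [hs, Real.sq_sqrt (by positivity)]; field_simp
  have hs1 : 1 ≤ s := by
    rw [hs, Real.one_le_sqrt, le_div_iff₀ hl0]; linarith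
  have r1 : 8 * s ≤ rad α n := Nat.le_ceil _
  have r2 : (rad α n : ℝ) < 8 * s + 1 := Nat.ceil_lt_add_one (by positivity)
  have r3 : (rad α n : ℝ) ≤ 9 * s := by linarith
  have a1 : 64 * n ≤ (rad α n : ℝ) ^ 2 * ell α n := by
    have : (8 * s) ^ 2 ≤ (rad α n : ℝ) ^ 2 := by gcongr
    nlinarith
  refine ⟨a1, ?_, ?_, ?_⟩
  · have : (rad α n : ℝ) ^ 2 ≤ (9 * s) ^ 2 := by gcongr
    nlinarith
  · have hq : √(n : ℝ) ^ 2 = n := Real.sq_sqrt (by linarith)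
    have hq0 : 0 < √(n : ℝ) := by positivity
    -- Here $\ell(n) \le \log n \le 2\sqrt n$, while $r^2\ell(n) \ge 64n$.
    have : 32 * √(n : ℝ) ≤ (rad α n : ℝ) ^ 2 := by
      by_contra! hc
      have : (rad α n : ℝ) ^ 2 * ell α n < 32 * √n * (2 * √n) := by
        calc _ < 32 * √n * ell α n := by gcongr
          _ ≤ _ := by gcongr; linarith
      nlinarith
    have h5 : (32 * √(n : ℝ)) ^ 2 ≤ ((rad α n : ℝ) ^ 2) ^ 2 := by gcongr
    nlinarith
  · have : (0 : ℝ) < rad α n := by linarith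
    exact_mod_cast this

theorem ell_le_four_mul_ell_rad (hα0 : 0 ≤ α) (hα1 : α ≤ 1) {n : ℕ} (hn : 3 ≤ n) :
    ell α n ≤ 4 * ell α (rad α n) := by
  obtain ⟨-, -, h3, h4⟩ := rad_estimates hα0 hα1 hn
  have hn' : (3 : ℝ) ≤ n := by exact_mod_cast hn
  have := ell_le_mul (k := 4) (s := rad α n) (t := n) hα0 hα1 (by norm_num) (by exact_mod_cast h4)
    (by linarith) h3
  exact_mod_cast this

/-- The normalisation in the theorem. -/
noncomputable def rate (α : ℝ) (N : ℕ) : ℝ := max (Real.log N ^ (1 - α)) (Real.log (Real.log N))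

/-- The order of the probability of a triple collision at time `j`. -/
noncomputable def colRate (α : ℝ) (j : ℕ) : ℝ := 1 / (j * ell α j)

theorem tendsto_loglog : Tendsto (fun N : ℕ => Real.log (Real.log N)) atTop atTop :=
  Real.tendsto_log_atTop.comp (Real.tendsto_log_atTop.comp tendsto_natCast_atTop_atTop)

theorem tendsto_rate : Tendsto (rate α) atTop atTop :=
  tendsto_atTop_mono (fun _ => le_max_right _ _) tendsto_loglog

theorem colRate_le_one (hα0 : 0 ≤ α) {j : ℕ} (hj : 3 ≤ j) : colRate α j ≤ 1 := by
  have hj' : (3 : ℝ) ≤ j := by exact_mod_cast hj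
  have h1 := one_le_ell hα0 hj'
  rw [colRate, div_le_one (by positivity)]
  nlinarith

theorem colRate_nonneg (j : ℕ) : 0 ≤ colRate α j := by
  have := ell_nonneg (α := α) j
  unfold colRate; positivity

theorem log_succ_sub_le {j : ℕ} (hj : 1 ≤ j) : Real.log (j + 1 : ℕ) - Real.log j ≤ 1 / j := by
  have hj' : (0 : ℝ) < j := by exact_mod_cast hj
  rw [← Real.log_div (by positivity) hj'.ne']
  refine (Real.log_le_sub_one_of_pos (by positivity)).trans (le_of_eq ?_)
  push_cast; field_simp; ring

theorem le_log_succ_sub {j : ℕ} (hj : 1 ≤ j) :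
    1 / ((j + 1 : ℕ) : ℝ) ≤ Real.log (j + 1 : ℕ) - Real.log j := by
  have hj' : (0 : ℝ) < j := by exact_mod_cast hj
  have := Real.log_le_sub_one_of_pos (show (0 : ℝ) < j / (j + 1 : ℕ) by positivity)
  rw [Real.log_div hj'.ne' (by positivity)] at this
  have e : (j : ℝ) / (j + 1 : ℕ) - 1 = - (1 / ((j + 1 : ℕ) : ℝ)) := by
    push_cast; field_simp; ring
  linarith

/-- As $\ell(j) \le \log j$, each term dominates an increment of $\log\log$. -/
theorem sum_colRate_ge_loglog (hα1 : α ≤ 1) {n₀ : ℕ} (hn₀ : 3 ≤ n₀) (N : ℕ) (hN : n₀ ≤ N) :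
    Real.log (Real.log (N : ℕ)) - Real.log (Real.log n₀) ≤ ∑ j ∈ Finset.Ico n₀ N, colRate α j := by
  induction N, hN using Nat.le_induction with
  | base => simp
  | succ N hN ih =>
    rw [Finset.sum_Ico_succ_top hN]
    have hN3 : (3 : ℝ) ≤ N := by exact_mod_cast hn₀.trans hN
    have hl := one_lt_log_of_three_le hN3
    have hl' : 1 < Real.log (N + 1 : ℕ) := one_lt_log_of_three_le (by push_cast; linarith)
    have h1 := log_succ_sub_le (j := N) (by omega)
    have h2 : Real.log (Real.log (N + 1 : ℕ)) - Real.log (Real.log N) ≤ colRate α N := by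
      rw [← Real.log_div (by linarith) (by linarith)]
      refine (Real.log_le_sub_one_of_pos (by positivity)).trans ?_
      rw [div_sub_one (by linarith), div_le_iff₀ (by linarith)]
      refine h1.trans ?_
      have := ell_le_log hα1 hN3
      have h0 : 0 < ell α N := by
        rw [ell_eq (by linarith)]; exact Real.rpow_pos_of_pos (by linarith) _
      unfold colRate
      rw [div_mul_eq_mul_div, one_mul, div_le_div_iff₀ (by linarith) (by positivity)]
      nlinarith
    linarith

theorem sum_colRate_ge_log (hα0 : 0 ≤ α) {n₀ : ℕ} (hn₀ : 3 ≤ n₀) (N : ℕ) (hN : n₀ ≤ N) :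
    (Real.log N - Real.log n₀) / ell α N ≤ ∑ j ∈ Finset.Ico n₀ N, colRate α j := by
  have h1 : Real.log N - Real.log n₀ ≤ ∑ j ∈ Finset.Ico n₀ N, 1 / (j : ℝ) := by
    induction N, hN using Nat.le_induction with
    | base => simp
    | succ N hN ih =>
      rw [Finset.sum_Ico_succ_top hN]
      linarith [log_succ_sub_le (j := N) (by omega)]
  have hN3 : (3 : ℝ) ≤ N := by exact_mod_cast hn₀.trans hN
  have hl := one_le_ell hα0 hN3
  calc _ ≤ (∑ j ∈ Finset.Ico n₀ N, 1 / (j : ℝ)) / ell α N := by gcongr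
    _ = ∑ j ∈ Finset.Ico n₀ N, 1 / (j : ℝ) / ell α N := Finset.sum_div _ _ _
    _ ≤ _ := by
        refine Finset.sum_le_sum fun j hj => ?_
        rw [Finset.mem_Ico] at hj
        have hj3 : (3 : ℝ) ≤ j := by exact_mod_cast hn₀.trans hj.1
        have h1 := one_le_ell hα0 hj3
        have h2 : ell α j ≤ ell α N := ell_mono hα0 (by
          simp; exact hj.2.le)
        unfold colRate
        rw [div_div]
        gcongr

theorem eventually_sum_colRate_ge (hα0 : 0 ≤ α) (hα1 : α ≤ 1) {n₀ : ℕ} (hn₀ : 3 ≤ n₀) :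
    ∀ᶠ N : ℕ in atTop, rate α N / 2 ≤ ∑ j ∈ Finset.Ico n₀ N, colRate α j := by
  have hlog : Tendsto (fun N : ℕ => Real.log N) atTop atTop :=
    Real.tendsto_log_atTop.comp tendsto_natCast_atTop_atTop
  filter_upwards [eventually_ge_atTop n₀, hlog.eventually_ge_atTop (2 * Real.log n₀),
    tendsto_loglog.eventually_ge_atTop (2 * Real.log (Real.log n₀))] with N h1 h2 h3
  rw [rate, div_le_iff₀ two_pos]
  refine max_le ?_ ?_
  · have hN3 : (3 : ℝ) ≤ N := by exact_mod_cast hn₀.trans h1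
    have h := sum_colRate_ge_log hα0 hn₀ N h1
    have hl := one_lt_log_of_three_le hN3
    have e : Real.log N ^ (1 - α) = Real.log N / ell α N := by
      rw [Real.rpow_sub (by linarith), Real.rpow_one, ell_eq (by linarith)]
    rw [e]
    have hl := one_le_ell hα0 hN3
    rw [div_le_iff₀ (by linarith)] at h ⊢
    linarith
  · have h := sum_colRate_ge_loglog hα1 hn₀ N h1
    linarith

/-- Each term is at most 1, so dropping the last `m` of them costs at most `m`. The shift makes room
for a history of length `m`. -/
theorem eventually_sum_colRate_shift_ge (hα0 : 0 ≤ α) (hα1 : α ≤ 1) {n₀ : ℕ} (hn₀ : 3 ≤ n₀)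
    (m : ℕ) : ∀ᶠ N : ℕ in atTop, rate α N / 2 - m ≤ ∑ j ∈ Finset.Ico n₀ (N - m), colRate α j := by
  filter_upwards [eventually_sum_colRate_ge hα0 hα1 hn₀, eventually_ge_atTop (n₀ + m)] with N h hN
  rw [← Finset.sum_Ico_consecutive _ (show n₀ ≤ N - m by omega) (show N - m ≤ N by omega)] at h
  have : ∑ j ∈ Finset.Ico (N - m) N, colRate α j ≤ m := by
    have := Finset.sum_le_card_nsmul (Finset.Ico (N - m) N) (colRate α) 1 (fun j hj => by
      rw [Finset.mem_Ico] at hj; exact colRate_le_one hα0 (by omega))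
    rw [Nat.card_Ico, nsmul_eq_mul, mul_one] at this
    exact this.trans (Nat.cast_le.2 (by omega))
  linarith

/-- The sum is compared with increments of $\log\log N$ when $\alpha = 1$, and of $(\log
N)^{1-\alpha}/(1-\alpha)$ otherwise; the constant may blow up as $\alpha \to 1$. -/
theorem exists_sum_colRate_le (hα0 : 0 ≤ α) (hα1 : α ≤ 1) :
    ∃ C : ℝ, 0 ≤ C ∧ ∀ N : ℕ, 3 ≤ N → ∑ j ∈ Finset.Ico 3 (N + 1), colRate α j ≤ 1 + C * rate α N := by
  rcases hα1.eq_or_lt with rfl | hlt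
  · refine ⟨1, zero_le_one, fun N hN => ?_⟩
    have h : ∑ j ∈ Finset.Ico 3 (N + 1), colRate 1 j ≤ 1 + Real.log (Real.log N) := by
      induction N, hN using Nat.le_induction with
      | base =>
        have h1 := colRate_le_one (α := 1) zero_le_one (le_refl 3)
        have h2 := Real.log_nonneg (one_lt_log_of_three_le (le_refl (3 : ℝ))).le
        simp; linarith
      | succ N hN ih =>
        rw [Finset.sum_Ico_succ_top (by omega)]
        have hN3 : (3 : ℝ) ≤ N := by exact_mod_cast hN
        have hl := one_lt_log_of_three_le hN3
        have hl' : 1 < Real.log (N + 1 : ℕ) := one_lt_log_of_three_le (by push_cast; linarith)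
        have h1 := le_log_succ_sub (j := N) (by omega)
        have h2 : colRate 1 (N + 1) ≤ Real.log (Real.log (N + 1 : ℕ)) - Real.log (Real.log N) := by
          have := Real.log_le_sub_one_of_pos
            (show 0 < Real.log N / Real.log (N + 1 : ℕ) by positivity)
          rw [Real.log_div (by linarith) (by linarith)] at this
          have e : Real.log N / Real.log (N + 1 : ℕ) - 1 =
              -((Real.log (N + 1 : ℕ) - Real.log N) / Real.log (N + 1 : ℕ)) := by
            rw [div_sub_one (by linarith), ← neg_div, neg_sub]
          have h3 : colRate 1 (N + 1) ≤
              (Real.log (N + 1 : ℕ) - Real.log N) / Real.log (N + 1 : ℕ) := by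
            rw [colRate, ell_eq (by push_cast; linarith), Real.rpow_one, ← div_div]
            gcongr
          linarith
        linarith
    refine h.trans ?_
    rw [one_mul]
    gcongr
    exact le_max_right _ _
  · have hβ : 0 < 1 - α := by linarith
    refine ⟨1 / (1 - α), by positivity, fun N hN => ?_⟩
    have h : ∑ j ∈ Finset.Ico 3 (N + 1), colRate α j ≤ 1 + 1 / (1 - α) * Real.log N ^ (1 - α) := by
      induction N, hN using Nat.le_induction with
      | base =>
        have h1 := colRate_le_one hα0 (le_refl 3)
        have h2 : 0 ≤ 1 / (1 - α) * Real.log (3 : ℕ) ^ (1 - α) := by positivity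
        simp at h2 ⊢; linarith
      | succ N hN ih =>
        rw [Finset.sum_Ico_succ_top (by omega)]
        have hN3 : (3 : ℝ) ≤ N := by exact_mod_cast hN
        have hl := one_lt_log_of_three_le hN3
        have hl' : 1 < Real.log (N + 1 : ℕ) := one_lt_log_of_three_le (by push_cast; linarith)
        have h1 := le_log_succ_sub (j := N) (by omega)
        set s := Real.log N
        set t := Real.log (N + 1 : ℕ)
        have h2 : (1 - α) * colRate α (N + 1) ≤ t ^ (1 - α) - s ^ (1 - α) := by
          -- Bernoulli's inequality at $s/t$ expresses the concavity of $t^{1-\alpha}$: the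
          -- increment is at least $(1-\alpha)(t-s)t^{-\alpha}$.
          have hb := rpow_one_add_le_one_add_mul_self (s := s / t - 1) (p := 1 - α)
            (by have : 0 < s / t := by positivity
                linarith) hβ.le (by linarith)
          rw [add_sub_cancel, Real.div_rpow (by linarith) (by linarith),
            div_le_iff₀ (by positivity)] at hb
          have e : (1 + (1 - α) * (s / t - 1)) * t ^ (1 - α) =
              t ^ (1 - α) - (1 - α) * ((t - s) * (t ^ (1 - α) / t)) := by
            field_simp; ring
          have e2 : t ^ (1 - α) / t = 1 / t ^ α := by
            rw [Real.rpow_sub (by linarith), Real.rpow_one]; field_simp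
          rw [e, e2] at hb
          have h3 : colRate α (N + 1) ≤ (t - s) * (1 / t ^ α) := by
            rw [colRate, ell_eq (by push_cast; linarith), one_div, mul_inv, ← one_div,
              ← one_div]
            gcongr
          have := mul_le_mul_of_nonneg_left h3 hβ.le
          linarith
        have h4 : colRate α (N + 1) ≤ 1 / (1 - α) * (t ^ (1 - α) - s ^ (1 - α)) := by
          rw [one_div_mul_eq_div, le_div_iff₀ hβ]; linarith
        linarith
    refine h.trans ?_
    gcongr
    exact le_max_left _ _

theorem sum_one_div_le (J : ℕ) (hJ : 1 ≤ J) :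
    ∑ j ∈ Finset.Ico 1 (J + 1), 1 / (j : ℝ) ≤ 1 + Real.log J := by
  induction J, hJ using Nat.le_induction with
  | base => simp
  | succ J hJ ih =>
    rw [Finset.sum_Ico_succ_top (by omega)]
    linarith [le_log_succ_sub hJ]

/-- Splitting the times at a power of the logarithm. -/
theorem eventually_split_le (hα0 : 0 ≤ α) (hα1 : α ≤ 1) (K : ℝ) (hK : 0 ≤ K) :
    ∃ C : ℝ, 0 < C ∧ ∀ᶠ N : ℕ in atTop, ∀ u : ℕ → ℝ, u 0 ≤ 1 → (∀ j, 1 ≤ j → u j ≤ K / j) →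
      (∀ j, 9 ≤ j → j ≤ N → Real.log (N + 1 : ℕ) ^ 4 ≤ (j / 2 : ℕ) → u j ≤ K * colRate α j) →
      ∑ j ∈ Finset.range (N + 1), u j ≤ C * rate α N := by
  obtain ⟨C, hC, hsum⟩ := exists_sum_colRate_le hα0 hα1
  -- The three summands account for $j = 0$, for $1 \le j \le J$ (using $\log J \le 5\log\log N$),
  -- and for the later times; `rate` is at least 1 here.
  refine ⟨1 + K * (1 + 5) + K * (1 + C), by positivity, ?_⟩
  have hlog : Tendsto (fun N : ℕ => Real.log N) atTop atTop :=
    Real.tendsto_log_atTop.comp tendsto_natCast_atTop_atTop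
  filter_upwards [eventually_ge_atTop 3, hlog.eventually_ge_atTop 100,
    tendsto_loglog.eventually_ge_atTop 1] with N hN3 hlogN hll u hu0 hu1 hu2
  have hN3' : (3 : ℝ) ≤ N := by exact_mod_cast hN3
  have hrate : Real.log (Real.log N) ≤ rate α N := le_max_right _ _
  set l := Real.log N
  have hl1 : Real.log (N + 1 : ℕ) ≤ l + 1 := by
    have := log_succ_sub_le (j := N) (by omega)
    have : (1 : ℝ) / N ≤ 1 := by rw [div_le_one (by linarith)]; linarith
    linarith
  have hl0 : 0 ≤ Real.log (N + 1 : ℕ) := Real.log_natCast_nonneg _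
  -- The fifth power exceeds the fourth power of the hypothesis by a factor $\log N$, which absorbs
  -- the numerical constants. Yet $\log J$ is still of order $\log\log N$.
  set J := ⌊l ^ 5⌋₊
  have hJ : (J : ℝ) ≤ l ^ 5 := Nat.floor_le (by positivity)
  have hJ' : l ^ 5 < J + 1 := Nat.lt_floor_add_one _
  have hJ2 : 100 ≤ J := Nat.le_floor (by
    push_cast
    calc (100 : ℝ) ≤ l := hlogN
      _ ≤ l ^ 5 := le_self_pow₀ (by linarith) (by norm_num))
  have hsplit : ∀ j ∈ Finset.range (N + 1), u j ≤ (if j = 0 then 1 else 0) +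
      (if j ∈ Finset.Ico 1 (J + 1) then K / j else 0) +
      (if j ∈ Finset.Ico 3 (N + 1) then K * colRate α j else 0) := by
    intro j hj
    have p1 : (0 : ℝ) ≤ if j = 0 then 1 else 0 := by split_ifs <;> norm_num
    have p2 : (0 : ℝ) ≤ if j ∈ Finset.Ico 1 (J + 1) then K / j else 0 := by
      split_ifs <;> positivity
    have p3 : (0 : ℝ) ≤ if j ∈ Finset.Ico 3 (N + 1) then K * colRate α j else 0 := by
      have := colRate_nonneg (α := α) j
      split_ifs <;> positivity
    rcases Nat.eq_zero_or_pos j with rfl | hj0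
    · simp at p2 p3 ⊢; linarith
    · by_cases hjJ : j ≤ J
      · rw [if_pos (Finset.mem_Ico.2 ⟨hj0, by omega⟩)] at p2 ⊢
        linarith [hu1 j hj0]
      · have hjN : j < N + 1 := Finset.mem_range.1 hj
        rw [if_pos (Finset.mem_Ico.2 (⟨by omega, hjN⟩ : 3 ≤ j ∧ j < N + 1))] at p3 ⊢
        have : Real.log (N + 1 : ℕ) ^ 4 ≤ (j / 2 : ℕ) := by
          have a1 : Real.log (N + 1 : ℕ) ^ 4 ≤ (l + 1) ^ 4 := by gcongr
          have a2 : (l + 1) ^ 4 ≤ (2 * l) ^ 4 := by gcongr; linarith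
          have a3 : (J : ℝ) + 1 ≤ j := by exact_mod_cast (by omega : J + 1 ≤ j)
          have a4 : (j : ℝ) ≤ 2 * (j / 2 : ℕ) + 1 := by exact_mod_cast (by omega : j ≤ 2 * (j / 2) + 1)
          have a5 : 100 * l ^ 4 ≤ l ^ 5 := by
            rw [pow_succ l 4, mul_comm]; gcongr
          have a6 : 1 ≤ l ^ 4 := one_le_pow₀ (by linarith)
          nlinarith
        linarith [hu2 j (by omega) (by omega) this]
  refine (Finset.sum_le_sum hsplit).trans ?_
  rw [Finset.sum_add_distrib, Finset.sum_add_distrib]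
  have t1 : ∑ j ∈ Finset.range (N + 1), (if j = 0 then (1 : ℝ) else 0) = 1 := by simp
  have t2 : ∑ j ∈ Finset.range (N + 1), (if j ∈ Finset.Ico 1 (J + 1) then K / j else 0) ≤
      K * (1 + Real.log J) := by
    rw [← Finset.sum_filter]
    calc _ ≤ ∑ j ∈ Finset.Ico 1 (J + 1), K / (j : ℝ) :=
          Finset.sum_le_sum_of_subset_of_nonneg (fun j hj => (Finset.mem_filter.1 hj).2)
            (fun j _ _ => by positivity)
      _ = K * ∑ j ∈ Finset.Ico 1 (J + 1), 1 / (j : ℝ) := by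
          rw [Finset.mul_sum]; simp [div_eq_mul_inv]
      _ ≤ _ := by gcongr; exact sum_one_div_le J (by omega)
  have t3 : ∑ j ∈ Finset.range (N + 1), (if j ∈ Finset.Ico 3 (N + 1) then K * colRate α j else 0) ≤
      K * (1 + C * rate α N) := by
    rw [← Finset.sum_filter]
    calc _ ≤ ∑ j ∈ Finset.Ico 3 (N + 1), K * colRate α j :=
          Finset.sum_le_sum_of_subset_of_nonneg (fun j hj => (Finset.mem_filter.1 hj).2)
            (fun j _ _ => mul_nonneg hK (colRate_nonneg _))
      _ = K * ∑ j ∈ Finset.Ico 3 (N + 1), colRate α j := by rw [Finset.mul_sum]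
      _ ≤ _ := by gcongr; exact hsum N hN3
  have t4 : Real.log J ≤ 5 * Real.log l := by
    have : Real.log (l ^ 5) = 5 * Real.log l := by rw [Real.log_pow]; norm_num
    rw [← this]
    exact Real.log_le_log (by exact_mod_cast (by omega : 0 < J)) hJ
  have t5 : K * (1 + Real.log J) ≤ K * ((1 + 5) * rate α N) := by gcongr; linarith
  have t6 : K * (1 + C * rate α N) ≤ K * ((1 + C) * rate α N) := by gcongr; linarith
  rw [t1]
  nlinarith

end LogSums

/-! ### Heat kernel and collision estimates on the comb -/

section CombHeatKernel

variable {α : ℝ}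

/-- A universal on-diagonal upper bound. -/
theorem dens_diag_le_sqrt {n : ℕ} (hn : 0 < n) (v : combLogVertices α) :
    dens (combLog α) (2 * n) v v ≤ 12 / √n := by
  classical
  have hn' : (1 : ℝ) ≤ n := by exact_mod_cast hn
  set s := √(n : ℝ) with hs
  have hs2 : s ^ 2 = n := Real.sq_sqrt (by linarith)
  have hs1 : 1 ≤ s := by rw [hs, Real.one_le_sqrt]; exact hn'
  set r := ⌈s⌉₊
  have r1 : s ≤ r := Nat.le_ceil _
  have r2 : (r : ℝ) ≤ 2 * s := by
    have := Nat.ceil_lt_add_one (show 0 ≤ s by linarith)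
    have h : (r : ℝ) < s + 1 := this
    linarith
  have r0 : 0 < r := by
    have : (0 : ℝ) < r := by linarith
    exact_mod_cast this
  -- About $\sqrt n$ vertices on a line: down the tooth if `v` is high enough, otherwise along the
  -- spine, which is then within distance `r`.
  obtain ⟨B, hBc, hB⟩ : ∃ B : Finset (combLogVertices α), B.card = r ∧
      ∀ w ∈ B, ∃ p : (combLog α).Walk v w, (p.length : ℝ) ≤ 2 * r := by
    by_cases hr : (r : ℤ) ≤ v.1.2
    · have hmem : ∀ i ∈ Finset.range r, (v.1.1, v.1.2 - (i : ℤ)) ∈ combLogVertices α := by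
        intro i hi
        have := Finset.mem_range.1 hi
        have := vertex_le_hgt v
        exact mem_combLogVertices.2 ⟨by dsimp only; omega, by dsimp only; omega⟩
      refine ⟨(Finset.range r).attach.map ⟨fun i => ⟨_, hmem i.1 i.2⟩, ?_⟩, by simp, ?_⟩
      · intro i j hij
        have : v.1.2 - (i.1 : ℤ) = v.1.2 - (j.1 : ℤ) := congrArg (fun u => u.1.2) hij
        ext; omega
      · intro w hw
        obtain ⟨i, -, rfl⟩ := Finset.mem_map.1 hw
        have hi := Finset.mem_range.1 i.2
        have hle := vertex_le_hgt v
        have hv : (v.1.1, v.1.2 - (i.1 : ℤ) + (i.1 : ℕ)) ∈ combLogVertices α := by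
          rw [sub_add_cancel]; exact v.2
        have e := exists_walk_tooth v.1.1 (v.1.2 - (i.1 : ℤ)) i.1 (by omega) (by omega) hv
          (hmem i.1 i.2)
        have h : (⟨(v.1.1, v.1.2 - (i.1 : ℤ) + (i.1 : ℕ)), hv⟩ : combLogVertices α) = v := by
          ext <;> simp
        rw [h] at e
        obtain ⟨p, hp⟩ := e
        refine ⟨p, ?_⟩
        rw [hp]
        exact_mod_cast (by omega : i.1 ≤ 2 * r)
    · refine ⟨(Finset.range r).map ⟨fun i : ℕ => ⟨(v.1.1 + 1 * (i : ℤ), 0), spine_mem _⟩, ?_⟩,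
        by simp, ?_⟩
      · intro i j hij
        have : v.1.1 + 1 * (i : ℤ) = v.1.1 + 1 * (j : ℤ) := congrArg (fun u => u.1.1) hij
        omega
      · intro w hw
        obtain ⟨i, hi, rfl⟩ := Finset.mem_map.1 hw
        have hi := Finset.mem_range.1 hi
        obtain ⟨p, hp⟩ := exists_walk_of_spine v ⟨(v.1.1 + 1 * (i : ℤ), 0), spine_mem _⟩ 1
          (by simp) i rfl
        refine ⟨p, ?_⟩
        have : (p.length : ℤ) ≤ 2 * r := by rw [hp]; dsimp only; omega
        exact_mod_cast this
  have h := dens_diag_le (G := combLog α) combLog_degree_pos combParity_adj hn v B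
    (Finset.card_pos.1 (by omega)) hB
  refine h.trans ?_
  rw [hBc]
  have h1 : 4 / (r : ℝ) ≤ 4 / s := by gcongr
  have h2 : 2 * (2 * (r : ℝ)) / n ≤ 8 / s := by
    rw [div_le_div_iff₀ (by linarith) (by linarith), ← hs2]; nlinarith
  have h3 : 12 / s = 4 / s + 8 / s := by ring
  linarith

/-- The on-diagonal upper bound at times that are large compared with the local tooth height. -/
theorem dens_diag_le_log (hα0 : 0 ≤ α) (hα1 : α ≤ 1) {n M : ℕ} (hn : 3 ≤ n) (hM : 1 ≤ M)
    (hMn : Real.log M ^ 4 ≤ n) (v : combLogVertices α) (hv : |v.1.1| ≤ M) :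
    dens (combLog α) (2 * n) v v ≤ 74 / √(n * ell α n) := by
  classical
  have hn' : (3 : ℝ) ≤ n := by exact_mod_cast hn
  have hl := one_le_ell hα0 hn'
  obtain ⟨h1, h2, h3, h4⟩ := rad_estimates hα0 hα1 hn
  set r := rad α n
  have hr1 : (1 : ℝ) ≤ r := by exact_mod_cast h4
  have hM' : (1 : ℝ) ≤ M := by exact_mod_cast hM
  -- This is the role of the condition on `M`: the tooth containing `v` has height at most `r`, so
  -- leaving it costs no more than the horizontal displacement.
  have hlogM : Real.log M ≤ r := le_of_pow_le_pow_left₀ (by norm_num : 4 ≠ 0) (by linarith)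
    (hMn.trans h3)
  have hva : (v.1.2 : ℝ) ≤ r := by
    have a1 : (v.1.2 : ℝ) ≤ ell α v.1.1 :=
      le_trans (by exact_mod_cast vertex_le_hgt v) (hgt_le_ell v.1.1)
    have a2 : ell α (v.1.1 : ℝ) ≤ ell α M := ell_mono hα0 (by
      rw [← Int.cast_abs, Nat.abs_cast]; exact_mod_cast hv)
    have a3 := ell_le_max hα0 hα1 (M : ℝ)
    rw [Nat.abs_cast, max_eq_left hM'] at a3
    exact a1.trans (a2.trans (a3.trans (max_le hr1 hlogM)))
  set k := ⌊ell α r⌋₊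
  have hk1 : (k : ℝ) ≤ ell α r := Nat.floor_le (ell_nonneg _)
  have hk2 : ell α r < k + 1 := Nat.lt_floor_add_one _
  have hkr : (k : ℝ) ≤ r := by
    refine hk1.trans ((ell_le_max hα0 hα1 _).trans (max_le hr1 ?_))
    rw [Nat.abs_cast, max_eq_left hr1]
    exact (Real.log_le_sub_one_of_pos (by linarith)).trans (by linarith)
  -- Moving away from the origin by $m \ge r$ steps reaches coordinates of modulus at least `r`,
  -- where every tooth has height at least $\lfloor\ell(r)\rfloor$.
  obtain ⟨s, hs, hsv⟩ : ∃ s : ℤ, |s| = 1 ∧ ∀ m : ℕ, (m : ℤ) ≤ |v.1.1 + s * m| := by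
    rcases le_total 0 v.1.1 with h | h
    · exact ⟨1, by simp, fun m => by rw [abs_of_nonneg] <;> omega⟩
    · exact ⟨-1, by simp, fun m => by rw [abs_of_nonpos] <;> omega⟩
  have hs0 : s ≠ 0 := by rintro rfl; simp at hs
  have hmem : ∀ q : ℕ × ℕ, q ∈ Finset.range r ×ˢ Finset.range (k + 1) →
      (v.1.1 + s * ((r + q.1 : ℕ) : ℤ), (q.2 : ℤ)) ∈ combLogVertices α := by
    intro q hq
    rw [Finset.mem_product, Finset.mem_range, Finset.mem_range] at hq
    refine ⟨by simp, ?_⟩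
    have b1 : ((q.2 : ℤ) : ℝ) ≤ k := by exact_mod_cast (by omega : q.2 ≤ k)
    refine (b1.trans hk1).trans (ell_mono (t := ((v.1.1 + s * ((r + q.1 : ℕ) : ℤ) : ℤ) : ℝ)) hα0 ?_)
    rw [Nat.abs_cast, ← Int.cast_abs]
    have := hsv (r + q.1)
    exact_mod_cast (by omega : (r : ℤ) ≤ |v.1.1 + s * ((r + q.1 : ℕ) : ℤ)|)
  -- A rectangle over the horizontal offsets $r, \dots, 2r-1$, with $k+1$ vertices on each tooth.
  set B : Finset (combLogVertices α) := (Finset.range r ×ˢ Finset.range (k + 1)).attach.map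
    ⟨fun q => ⟨_, hmem q.1 q.2⟩, by
      rintro ⟨⟨i, y⟩, hq⟩ ⟨⟨i', y'⟩, hq'⟩ h
      have e1 : v.1.1 + s * ((r + i : ℕ) : ℤ) = v.1.1 + s * ((r + i' : ℕ) : ℤ) :=
        congrArg (fun u => u.1.1) h
      have e2 : (y : ℤ) = y' := congrArg (fun u => u.1.2) h
      have e3 := mul_left_cancel₀ hs0 (add_left_cancel e1)
      have e4 : i = i' := by omega
      have e5 : y = y' := by omega
      subst e4 e5; rfl⟩ with hBdef
  have hBc : (B.card : ℝ) = r * (k + 1) := by simp [B]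
  have hB0 : 0 < (B.card : ℝ) := by rw [hBc]; positivity
  have hB : ∀ w ∈ B, ∃ p : (combLog α).Walk v w, (p.length : ℝ) ≤ 4 * r := by
    intro w hw
    obtain ⟨⟨q, hq⟩, -, rfl⟩ := Finset.mem_map.1 hw
    obtain ⟨p, hp⟩ := exists_walk_of_spine v ⟨_, hmem q hq⟩ s hs (r + q.1) rfl
    refine ⟨p, ?_⟩
    rw [Finset.mem_product, Finset.mem_range, Finset.mem_range] at hq
    have c1 : (p.length : ℝ) = v.1.2 + (r + q.1 : ℕ) + q.2 := by exact_mod_cast hp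
    have c2 : (q.1 : ℝ) ≤ r := by exact_mod_cast hq.1.le
    have c3 : (q.2 : ℝ) ≤ k := by exact_mod_cast (by omega : q.2 ≤ k)
    rw [c1]; push_cast; linarith
  have h := dens_diag_le (G := combLog α) combLog_degree_pos combParity_adj (by omega : 0 < n) v B
    (Finset.card_pos.1 (by exact_mod_cast hB0)) hB
  refine h.trans ?_
  have hlr := ell_le_four_mul_ell_rad hα0 hα1 hn
  have hn0 : (0 : ℝ) < n := by linarith
  set T := √((n : ℝ) * ell α n) with hT
  have hT2 : T ^ 2 = n * ell α n := Real.sq_sqrt (by positivity)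
  have hT0 : 0 < T := by positivity
  -- From $r^2\ell(n)^2 \ge 64T^2$ and $\ell(n) \le 4\ell(r) \le 4(k+1)$.
  have d1 : 2 * T ≤ B.card := by
    have : 8 * T ≤ r * ell α n := by
      refine le_of_abs_le (abs_le_of_sq_le_sq ?_ (by positivity))
      nlinarith
    rw [hBc]
    have : (r : ℝ) * ell α n ≤ r * (4 * (k + 1)) := by gcongr; linarith
    linarith
  have d2 : r * T ≤ 9 * n := by
    refine le_of_abs_le (abs_le_of_sq_le_sq ?_ (by positivity))
    nlinarith
  have e1 : 4 / (B.card : ℝ) ≤ 2 / T := by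
    rw [div_le_div_iff₀ hB0 hT0]; linarith
  have e2 : 2 * (4 * (r : ℝ)) / n ≤ 72 / T := by
    rw [div_le_div_iff₀ hn0 hT0]; linarith
  have e3 : 74 / T = 2 / T + 72 / T := by ring
  linarith

/-- Cauchy–Schwarz bounds the off-diagonal density by the diagonal ones; the factor 3 is the largest
degree. -/
theorem heat_even_le {n : ℕ} {b : ℝ} (hb : 0 ≤ b) {x w : combLogVertices α}
    (hx : dens (combLog α) (2 * n) x x ≤ b) (hw : dens (combLog α) (2 * n) w w ≤ b) :
    heat (combLog α) (2 * n) x w ≤ 3 * b := by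
  have h := dens_even_sq_le (G := combLog α) combLog_degree_pos n w x
  have h0 := dens_nonneg (G := combLog α) (2 * n) x x
  have h1 : dens (combLog α) (2 * n) w x ≤ b := by
    refine le_of_abs_le (abs_le_of_sq_le_sq ?_ hb)
    nlinarith
  rw [dens_eq_heat_div, div_le_iff₀ (degree_pos_le w).1] at h1
  have := degree_pos_le w
  nlinarith

theorem heat_succ_le {n : ℕ} {b : ℝ} {x w : combLogVertices α}
    (h : ∀ z, (combLog α).Adj x z → heat (combLog α) n z w ≤ b) :
    heat (combLog α) (n + 1) x w ≤ b := by
  unfold heat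
  rw [Function.iterate_succ_apply']
  unfold avg
  rw [div_le_iff₀ (degree_pos_le x).1]
  have := Finset.sum_le_card_nsmul ((combLog α).neighborFinset x)
    (fun z => heat (combLog α) n z w) b (fun z hz => h z (by simpa using hz))
  rw [SimpleGraph.card_neighborFinset_eq_degree, nsmul_eq_mul, mul_comm] at this
  exact this

theorem heat_le_sqrt {j : ℕ} (hj : 1 ≤ j) (x w : combLogVertices α) :
    heat (combLog α) j x w ≤ 63 / √j := by
  rcases hj.eq_or_lt with rfl | hj2
  · have := heat_le_one (G := combLog α) combLog_degree_pos 1 x w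
    norm_num; linarith
  · set n := j / 2 with hn
    have hn0 : 0 < n := by omega
    have hb : 0 ≤ 12 / √(n : ℝ) := by positivity
    have h1 : ∀ z, heat (combLog α) (2 * n) z w ≤ 3 * (12 / √(n : ℝ)) := fun z =>
      heat_even_le hb (dens_diag_le_sqrt hn0 z) (dens_diag_le_sqrt hn0 w)
    have h2 : heat (combLog α) j x w ≤ 3 * (12 / √(n : ℝ)) := by
      rcases Nat.mod_two_eq_zero_or_one j with h | h
      · rw [show j = 2 * n by omega]; exact h1 x
      · rw [show j = 2 * n + 1 by omega]; exact heat_succ_le fun z _ => h1 z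
    refine h2.trans ?_
    have hj0 : (0 : ℝ) < j := by exact_mod_cast hj
    have hn0' : (0 : ℝ) < n := by exact_mod_cast hn0
    have h3 : (j : ℝ) ≤ 3 * n := by exact_mod_cast (by omega : j ≤ 3 * n)
    have h4 : 36 * √(j : ℝ) ≤ 63 * √(n : ℝ) := by
      refine le_of_abs_le (abs_le_of_sq_le_sq ?_ (by positivity))
      rw [mul_pow, mul_pow, Real.sq_sqrt hj0.le, Real.sq_sqrt hn0'.le]
      linarith
    rw [← mul_div_assoc, div_le_div_iff₀ (by positivity) (by positivity)]
    linarith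

theorem heat_sq_le_div {j : ℕ} (hj : 1 ≤ j) (x w : combLogVertices α) :
    heat (combLog α) j x w ^ 2 ≤ 3969 / j := by
  have h := heat_le_sqrt hj x w
  have h0 := heat_nonneg (G := combLog α) j x w
  have hj0 : (0 : ℝ) ≤ j := Nat.cast_nonneg _
  calc _ ≤ (63 / √(j : ℝ)) ^ 2 := by gcongr
    _ = _ := by rw [div_pow, Real.sq_sqrt hj0]; norm_num

theorem abs_le_succ_of_adj {N : ℕ} {x z : combLogVertices α} (h : (combLog α).Adj x z)
    (hx : |x.1.1| ≤ N) : |z.1.1| ≤ (N + 1 : ℕ) := by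
  rw [combLog_adj, abs_eq zero_le_one, abs_eq zero_le_one] at h
  rw [abs_le] at *
  push_cast
  omega

/-- The diagonal bound is applied at the even time $2\lfloor j/2\rfloor$, and an odd `j` is reached
by averaging over the first step. That step may leave the box, hence $N+1$ in the logarithm. -/
theorem heat_sq_le_colRate (hα0 : 0 ≤ α) (hα1 : α ≤ 1) {j N : ℕ} (hj : 9 ≤ j)
    (hN : Real.log (N + 1 : ℕ) ^ 4 ≤ (j / 2 : ℕ)) {x w : combLogVertices α} (hx : |x.1.1| ≤ N)
    (hw : |w.1.1| ≤ N) : heat (combLog α) j x w ^ 2 ≤ 295704 * colRate α j := by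
  set n := j / 2 with hn
  have hn3 : 3 ≤ n := by omega
  have hn' : (3 : ℝ) ≤ n := by exact_mod_cast hn3
  have hj' : (9 : ℝ) ≤ j := by exact_mod_cast hj
  have hl := one_le_ell hα0 hn'
  have hb : 0 ≤ 74 / √((n : ℝ) * ell α n) := by positivity
  have hd : ∀ z : combLogVertices α, |z.1.1| ≤ (N + 1 : ℕ) →
      dens (combLog α) (2 * n) z z ≤ 74 / √((n : ℝ) * ell α n) := fun z hz =>
    dens_diag_le_log hα0 hα1 hn3 (by omega) hN z hz
  have h1 : ∀ z : combLogVertices α, |z.1.1| ≤ (N + 1 : ℕ) →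
      heat (combLog α) (2 * n) z w ≤ 3 * (74 / √((n : ℝ) * ell α n)) := fun z hz =>
    heat_even_le hb (hd z hz) (hd w (by push_cast; omega))
  have h2 : heat (combLog α) j x w ≤ 3 * (74 / √((n : ℝ) * ell α n)) := by
    rcases Nat.mod_two_eq_zero_or_one j with h | h
    · rw [show j = 2 * n by omega]; exact h1 x (by push_cast; omega)
    · rw [show j = 2 * n + 1 by omega]
      exact heat_succ_le fun z hz => h1 z (abs_le_succ_of_adj hz hx)
  have h0 := heat_nonneg (G := combLog α) j x w
  have h3 : (j : ℝ) ≤ 3 * n := by exact_mod_cast (by omega : j ≤ 3 * n)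
  have h4 : ell α j ≤ 2 * ell α n := by
    have := ell_le_mul (k := 2) (s := n) (t := j) hα0 hα1 (by norm_num) (by linarith)
      (by linarith) (by nlinarith)
    exact_mod_cast this
  have hlj := one_le_ell hα0 (show (3 : ℝ) ≤ j by linarith)
  calc _ ≤ (3 * (74 / √((n : ℝ) * ell α n))) ^ 2 := by gcongr
    _ = 49284 / (n * ell α n) := by
        rw [mul_pow, div_pow, Real.sq_sqrt (by positivity)]; ring
    _ ≤ 295704 / (j * ell α j) := by
        rw [div_le_div_iff₀ (by positivity) (by positivity)]
        have : (j : ℝ) * ell α j ≤ (3 * n) * (2 * ell α n) := by gcongr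
        linarith
    _ = _ := by unfold colRate; ring

/-- The expected number of collisions of three walks started from a common vertex is at most of
order `rate`. -/
theorem exists_sum_heat_cube_le (hα0 : 0 ≤ α) (hα1 : α ≤ 1) :
    ∃ C : ℝ, 0 < C ∧ ∀ᶠ N : ℕ in atTop, ∀ x ∈ box α N,
      ∑ j ∈ Finset.range (N + 1), ∑ w ∈ box α N, heat (combLog α) j x w ^ 3 ≤ C * rate α N := by
  obtain ⟨C, hC, h⟩ := eventually_split_le hα0 hα1 295704 (by norm_num)
  refine ⟨C, hC, h.mono fun N hN x hx => ?_⟩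
  -- One factor of the cube is summed as a sub-probability; the other two are bounded uniformly.
  have key : ∀ j b, 0 ≤ b → (∀ w ∈ box α N, heat (combLog α) j x w ^ 2 ≤ b) →
      ∑ w ∈ box α N, heat (combLog α) j x w ^ 3 ≤ b := by
    intro j b hb0 hb
    calc _ ≤ ∑ w ∈ box α N, b * heat (combLog α) j x w := by
          refine Finset.sum_le_sum fun w hw => ?_
          rw [pow_succ]
          exact mul_le_mul_of_nonneg_right (hb w hw) (heat_nonneg _ _ _)
      _ = b * ∑ w ∈ box α N, heat (combLog α) j x w := by rw [Finset.mul_sum]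
      _ ≤ b * 1 := by gcongr; exact sum_heat_le_one combLog_degree_pos _ _ _
      _ = b := mul_one b
  refine hN _ ?_ ?_ ?_
  · refine key 0 1 zero_le_one fun w _ => ?_
    exact pow_le_one₀ (heat_nonneg _ _ _) (heat_le_one combLog_degree_pos _ _ _)
  · intro j hj
    refine key j _ (by positivity) fun w _ => (heat_sq_le_div hj x w).trans ?_
    gcongr; norm_num
  · intro j hj hjN hlog
    refine key j _ (mul_nonneg (by norm_num) (colRate_nonneg _)) fun w hw => ?_
    exact heat_sq_le_colRate hα0 hα1 hj hlog ((mem_box hα0).1 hx) ((mem_box hα0).1 hw)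

/-- Lower bound for the probability of a triple collision of walks with common starting point. -/
theorem sum_heat_cube_ge (hα0 : 0 ≤ α) (hα1 : α ≤ 1) {n N : ℕ} (hn : 729 ≤ n) (hnN : n ≤ N)
    (x : combLogVertices α) (hx : lyapG α x.1 + 1 ≤ n) :
    colRate α n / 127008 ≤ ∑ w ∈ box α N, heat (combLog α) n x w ^ 3 := by
  have hn' : (729 : ℝ) ≤ n := by exact_mod_cast hn
  have hl := one_le_ell hα0 (show (3 : ℝ) ≤ n by linarith)
  obtain ⟨h1, h2, h3, h4⟩ := rad_estimates hα0 hα1 (show 3 ≤ n by omega)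
  have hlr := ell_le_four_mul_ell_rad hα0 hα1 (show 3 ≤ n by omega)
  set r := rad α n
  have hr1 : (1 : ℝ) ≤ r := by exact_mod_cast h4
  -- This is where $729 = 9\cdot 81$ enters: $(3r)^2 \le 9\cdot 81\,n \le n^2$. It places the box of
  -- radius $3r$ inside `box α N`.
  have h3r : 3 * r ≤ n := by
    have : (3 * r : ℝ) ≤ n := by
      refine le_of_abs_le (abs_le_of_sq_le_sq ?_ (by linarith))
      nlinarith
    exact_mod_cast this
  have hF : 16 * n ≤ lyapF α (3 * r) := by
    have := lyapF_ge_ell hα0 r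
    nlinarith [sq_nonneg (r : ℝ)]
  have hbox := sum_heat_box_ge hα0 hα1 n (3 * r) (by omega) x
  have hhalf : 1 / 2 ≤ ∑ w ∈ box α (3 * r), heat (combLog α) n x w := by
    have : 2 * (lyapG α x.1 + n + 1) / lyapF α (3 * r) ≤ 1 / 2 := by
      rw [div_le_iff₀ (by linarith)]; linarith
    linarith
  have hcard : ((box α (3 * r)).card : ℝ) ≤ 14 * r * ell α n := by
    refine (card_box_le hα0 _).trans ?_
    have : ell α (3 * r : ℕ) ≤ ell α n := ell_mono hα0 (by
      rw [Nat.abs_cast, Nat.abs_cast]; exact_mod_cast h3r)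
    calc _ ≤ (7 * r : ℝ) * (2 * ell α n) := by
          push_cast at this ⊢
          have h0 := ell_nonneg (α := α) (3 * r)
          gcongr <;> linarith
      _ = _ := by ring
  -- For a given mass on a given number of vertices, the sum of cubes is smallest when the mass is
  -- spread evenly.
  have hpow := pow_sum_div_card_le_sum_pow (s := box α (3 * r))
    (f := fun w => heat (combLog α) n x w) (fun w _ => heat_nonneg _ _ _) 2
  have hc0 : 0 < ((box α (3 * r)).card : ℝ) := by
    rcases (box α (3 * r)).eq_empty_or_nonempty with h | h
    · rw [h] at hhalf; norm_num at hhalf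
    · exact_mod_cast h.card_pos
  -- $127008 = 2^3\cdot 14^2\cdot 81$.
  calc colRate α n / 127008 ≤ (1 / 2) ^ 3 / (14 * r * ell α n) ^ 2 := by
        unfold colRate
        rw [div_div, div_le_div_iff₀ (by positivity) (by positivity)]
        have : (r : ℝ) ^ 2 * ell α n * ell α n ≤ 81 * n * ell α n := by gcongr
        nlinarith
    _ ≤ (∑ w ∈ box α (3 * r), heat (combLog α) n x w) ^ 3 / (box α (3 * r)).card ^ 2 := by
        gcongr
    _ ≤ ∑ w ∈ box α (3 * r), heat (combLog α) n x w ^ 3 := hpow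
    _ ≤ _ := by
        refine Finset.sum_le_sum_of_subset_of_nonneg (fun w hw => ?_)
          (fun w _ _ => pow_nonneg (heat_nonneg _ _ _) 3)
        rw [mem_box hα0] at hw ⊢
        push_cast at hw
        omega

/-- The squared `ℓ²` distance of the heat kernels from two vertices of equal parity. -/
theorem exists_sum_sq_sub_heat_le {x y : combLogVertices α}
    (hxy : Even (combParity x + combParity y)) :
    ∃ K : ℝ, 0 < K ∧ ∀ j : ℕ, 1 ≤ j → ∀ S : Finset (combLogVertices α),
      ∑ w ∈ S, (heat (combLog α) j y w - heat (combLog α) j x w) ^ 2 ≤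
        K * (j : ℝ) ^ (-(3 / 4) : ℝ) := by
  obtain ⟨p⟩ := combLog_exists_walk x y
  refine ⟨18 * √(24 * (p.length + 1)), by positivity, fun j hj S => ?_⟩
  have hj0 : (0 : ℝ) < j := by exact_mod_cast hj
  have h := ip_dens_sub_le (G := combLog α) combLog_degree_pos combParity_adj
    (show 0 < j by omega) hxy p
  -- With the universal bound $12/\sqrt j$, the quantity under the root is of order $j^{-3/2}$.
  have hb : ∀ v : combLogVertices α, √(2 * p.length / j * dens (combLog α) (2 * j) v v) ≤
      √(24 * (p.length + 1)) * (j : ℝ) ^ (-(3 / 4) : ℝ) := by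
    intro v
    have h1 := dens_diag_le_sqrt (α := α) (show 0 < j by omega) v
    have e : (j : ℝ) ^ (-(3 / 4) : ℝ) = √((j : ℝ) ^ (-(3 / 2) : ℝ)) := by
      rw [Real.sqrt_eq_rpow, ← Real.rpow_mul hj0.le]; norm_num
    rw [e, ← Real.sqrt_mul (by positivity)]
    refine Real.sqrt_le_sqrt ?_
    have e2 : (j : ℝ) ^ (-(3 / 2) : ℝ) = 1 / (j * √j) := by
      rw [Real.sqrt_eq_rpow, ← Real.rpow_one_add' hj0.le (by norm_num), one_div,
        ← Real.rpow_neg hj0.le]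
      norm_num
    calc 2 * p.length / j * dens (combLog α) (2 * j) v v ≤ 2 * (p.length + 1) / j * (12 / √j) := by
          gcongr
          · exact dens_nonneg _ _ _
          · linarith
      _ = _ := by rw [e2]; field_simp; ring
  have h2 : ∀ w, (heat (combLog α) j y w - heat (combLog α) j x w) ^ 2 ≤
      9 * ((dens (combLog α) j x - dens (combLog α) j y) w) ^ 2 := by
    intro w
    obtain ⟨d0, d3⟩ := degree_pos_le w
    have e1 : ∀ z, heat (combLog α) j z w = (combLog α).degree w * dens (combLog α) j z w := by
      intro z
      rw [dens_symm combLog_degree_pos, dens_eq_heat_div]; field_simp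
    rw [e1, e1, ← mul_sub, mul_pow, Pi.sub_apply, ← neg_sub, neg_sq]
    have : ((combLog α).degree w : ℝ) ^ 2 ≤ 9 := by nlinarith
    gcongr
  calc _ ≤ ∑ w ∈ S, 9 * ((dens (combLog α) j x - dens (combLog α) j y) w) ^ 2 :=
        Finset.sum_le_sum fun w _ => h2 w
    _ = 9 * ∑ w ∈ S, ((dens (combLog α) j x - dens (combLog α) j y) w) ^ 2 := by
        rw [Finset.mul_sum]
    _ ≤ 9 * (2 * (√(24 * (p.length + 1)) * (j : ℝ) ^ (-(3 / 4) : ℝ))) := by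
        gcongr
        refine (sum_sq_le_ip combLog_degree_pos
          (support_sub_finite (support_dens_finite _ _) (support_dens_finite _ _)) S).trans ?_
        linarith [hb x, hb y]
    _ = _ := by ring

theorem sum_heat_sq_le {j : ℕ} (hj : 1 ≤ j) (x : combLogVertices α)
    (S : Finset (combLogVertices α)) :
    ∑ w ∈ S, heat (combLog α) j x w ^ 2 ≤ 63 * (j : ℝ) ^ (-(1 / 2) : ℝ) := by
  have e : 63 / √(j : ℝ) = 63 * (j : ℝ) ^ (-(1 / 2) : ℝ) := by
    rw [Real.rpow_neg (Nat.cast_nonneg _), Real.sqrt_eq_rpow, div_eq_mul_inv]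
  rw [← e]
  calc _ ≤ ∑ w ∈ S, 63 / √(j : ℝ) * heat (combLog α) j x w := by
        refine Finset.sum_le_sum fun w _ => ?_
        rw [sq]
        exact mul_le_mul_of_nonneg_right (heat_le_sqrt hj x w) (heat_nonneg _ _ _)
    _ = 63 / √(j : ℝ) * ∑ w ∈ S, heat (combLog α) j x w := by rw [Finset.mul_sum]
    _ ≤ 63 / √(j : ℝ) * 1 := by gcongr; exact sum_heat_le_one combLog_degree_pos _ _ _
    _ = _ := mul_one _

/-- The factor from `x` is bounded uniformly by $O(j^{-1/2})$. Cauchy–Schwarz bounds the rest by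
$\sqrt{j^{-1/2}\, j^{-3/4}} = j^{-5/8}$. The resulting exponent exceeds 1 in modulus, so these
errors are summable over all times. -/
theorem exists_sum_mul_abs_sub_le {x y : combLogVertices α}
    (hxy : Even (combParity x + combParity y)) (z : combLogVertices α) :
    ∃ K : ℝ, 0 < K ∧ ∀ j : ℕ, 1 ≤ j → ∀ S : Finset (combLogVertices α),
      ∑ w ∈ S, heat (combLog α) j x w * (heat (combLog α) j z w *
        |heat (combLog α) j y w - heat (combLog α) j x w|) ≤ K * (j : ℝ) ^ (-(9 / 8) : ℝ) := by
  obtain ⟨K, hK, h⟩ := exists_sum_sq_sub_heat_le hxy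
  refine ⟨63 * √(63 * K), by positivity, fun j hj S => ?_⟩
  have hj0 : (0 : ℝ) < j := by exact_mod_cast hj
  have e : 63 / √(j : ℝ) = 63 * (j : ℝ) ^ (-(1 / 2) : ℝ) := by
    rw [Real.rpow_neg hj0.le, Real.sqrt_eq_rpow, div_eq_mul_inv]
  have hcs := Finset.sum_mul_sq_le_sq_mul_sq S (fun w => heat (combLog α) j z w)
    (fun w => |heat (combLog α) j y w - heat (combLog α) j x w|)
  simp only [sq_abs] at hcs
  have h1 : ∑ w ∈ S, heat (combLog α) j z w * |heat (combLog α) j y w - heat (combLog α) j x w| ≤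
      √(63 * K) * (j : ℝ) ^ (-(5 / 8) : ℝ) := by
    have e2 : (j : ℝ) ^ (-(5 / 8) : ℝ) = √((j : ℝ) ^ (-(1 / 2) : ℝ) * (j : ℝ) ^ (-(3 / 4) : ℝ)) := by
      rw [Real.sqrt_eq_rpow, ← Real.rpow_add hj0, ← Real.rpow_mul hj0.le]; norm_num
    rw [e2, ← Real.sqrt_mul (by positivity)]
    refine Real.le_sqrt_of_sq_le (hcs.trans ?_)
    calc _ ≤ (63 * (j : ℝ) ^ (-(1 / 2) : ℝ)) * (K * (j : ℝ) ^ (-(3 / 4) : ℝ)) := by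
          exact mul_le_mul (sum_heat_sq_le hj z S) (h j hj S)
            (Finset.sum_nonneg fun w _ => sq_nonneg _) (by positivity)
      _ = _ := by ring
  calc _ ≤ ∑ w ∈ S, 63 / √(j : ℝ) * (heat (combLog α) j z w *
        |heat (combLog α) j y w - heat (combLog α) j x w|) := by
        refine Finset.sum_le_sum fun w _ => ?_
        exact mul_le_mul_of_nonneg_right (heat_le_sqrt hj x w)
          (mul_nonneg (heat_nonneg _ _ _) (abs_nonneg _))
    _ = 63 * (j : ℝ) ^ (-(1 / 2) : ℝ) * ∑ w ∈ S, heat (combLog α) j z w *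
        |heat (combLog α) j y w - heat (combLog α) j x w| := by rw [Finset.mul_sum, e]
    _ ≤ 63 * (j : ℝ) ^ (-(1 / 2) : ℝ) * (√(63 * K) * (j : ℝ) ^ (-(5 / 8) : ℝ)) := by gcongr
    _ = 63 * √(63 * K) * ((j : ℝ) ^ (-(1 / 2) : ℝ) * (j : ℝ) ^ (-(5 / 8) : ℝ)) := by ring
    _ = _ := by rw [← Real.rpow_add hj0]; norm_num

/-- The expected number of collisions of three walks started from arbitrary vertices of equal
parity is at least of order `rate`. -/
theorem eventually_sum_heat_ge (hα0 : 0 ≤ α) (hα1 : α ≤ 1) {x y z : combLogVertices α}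
    (hxy : Even (combParity x + combParity y)) (hxz : Even (combParity x + combParity z)) (m : ℕ) :
    ∀ᶠ N : ℕ in atTop, rate α N / 508032 ≤ ∑ j ∈ Finset.Ico 1 (N - m), ∑ w ∈ box α N,
      heat (combLog α) j x w * heat (combLog α) j y w * heat (combLog α) j z w := by
  obtain ⟨K₁, hK₁, h₁⟩ := exists_sum_mul_abs_sub_le hxy z
  obtain ⟨K₂, hK₂, h₂⟩ := exists_sum_mul_abs_sub_le hxz x
  -- From this time on, `sum_heat_cube_ge` applies at `x`.
  set n₀ := max 729 ⌈lyapG α x.1 + 1⌉₊ with hn₀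
  have hn₀729 : 729 ≤ n₀ := le_max_left _ _
  have hs : Summable fun j : ℕ => (j : ℝ) ^ (-(9 / 8) : ℝ) :=
    Real.summable_nat_rpow.2 (by norm_num)
  set T₀ := ∑' j : ℕ, (j : ℝ) ^ (-(9 / 8) : ℝ)
  -- The threshold makes the lost terms and the total error at most half of the main term
  -- $(\text{rate}/2)/127008$; what remains is $\text{rate}/508032$.
  filter_upwards [eventually_sum_colRate_shift_ge hα0 hα1 (show 3 ≤ n₀ by omega) m,
    tendsto_rate.eventually_ge_atTop (4 * (m + 127008 * ((K₁ + K₂) * T₀)))] with N h3 h4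
  have hterm : ∀ j ∈ Finset.Ico n₀ (N - m),
      colRate α j / 127008 - (K₁ + K₂) * (j : ℝ) ^ (-(9 / 8) : ℝ) ≤ ∑ w ∈ box α N,
        heat (combLog α) j x w * heat (combLog α) j y w * heat (combLog α) j z w := by
    intro j hj
    rw [Finset.mem_Ico] at hj
    have a1 := sum_heat_cube_ge hα0 hα1 (show 729 ≤ j by omega) (show j ≤ N by omega) x
      (le_trans (Nat.le_ceil _) (by exact_mod_cast (le_max_right _ _).trans hj.1))
    have a2 := h₁ j (by omega) (box α N)
    have a3 := h₂ j (by omega) (box α N)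
    -- With $P, Q, R$ the kernels from $x, y, z$, this is $P^3 = PQR + PR(P-Q) + P^2(P-R)$.
    have a4 : ∑ w ∈ box α N, heat (combLog α) j x w ^ 3 ≤
        ∑ w ∈ box α N, heat (combLog α) j x w * heat (combLog α) j y w * heat (combLog α) j z w +
        ∑ w ∈ box α N, heat (combLog α) j x w * (heat (combLog α) j z w *
          |heat (combLog α) j y w - heat (combLog α) j x w|) +
        ∑ w ∈ box α N, heat (combLog α) j x w * (heat (combLog α) j x w *
          |heat (combLog α) j z w - heat (combLog α) j x w|) := by
      rw [← Finset.sum_add_distrib, ← Finset.sum_add_distrib]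
      refine Finset.sum_le_sum fun w _ => ?_
      set P := heat (combLog α) j x w
      set Q := heat (combLog α) j y w
      set R := heat (combLog α) j z w
      have hP : 0 ≤ P := heat_nonneg _ _ _
      have hR : 0 ≤ R := heat_nonneg _ _ _
      have b1 : P * (R * -(Q - P)) ≤ P * (R * |Q - P|) := by gcongr; exact neg_le_abs _
      have b2 : P * (P * -(R - P)) ≤ P * (P * |R - P|) := by gcongr; exact neg_le_abs _
      nlinarith
    linarith
  have hsub : ∑ j ∈ Finset.Ico n₀ (N - m), ∑ w ∈ box α N,
        heat (combLog α) j x w * heat (combLog α) j y w * heat (combLog α) j z w ≤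
      ∑ j ∈ Finset.Ico 1 (N - m), ∑ w ∈ box α N,
        heat (combLog α) j x w * heat (combLog α) j y w * heat (combLog α) j z w := by
    refine Finset.sum_le_sum_of_subset_of_nonneg ?_ fun j _ _ => Finset.sum_nonneg fun w _ =>
      mul_nonneg (mul_nonneg (heat_nonneg _ _ _) (heat_nonneg _ _ _)) (heat_nonneg _ _ _)
    intro j hj
    rw [Finset.mem_Ico] at hj ⊢; omega
  refine le_trans ?_ hsub
  refine le_trans ?_ (Finset.sum_le_sum hterm)
  rw [Finset.sum_sub_distrib, ← Finset.sum_div, ← Finset.mul_sum]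
  have h5 : ∑ j ∈ Finset.Ico n₀ (N - m), (j : ℝ) ^ (-(9 / 8) : ℝ) ≤ T₀ :=
    hs.sum_le_tsum _ fun j _ => by positivity
  have h6 : (K₁ + K₂) * ∑ j ∈ Finset.Ico n₀ (N - m), (j : ℝ) ^ (-(9 / 8) : ℝ) ≤ (K₁ + K₂) * T₀ := by
    gcongr
  linarith

end CombHeatKernel

/-! ### Events determined by the past, and a zero-one argument -/

section ProcessHistory

variable {V Ω : Type*}

/-- The event `E` is determined by the values of the process `X` up to time `n`. -/
def IsPast (X : ℕ → Ω → V) (n : ℕ) (E : Set Ω) : Prop :=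
  ∀ ω ω', (∀ k ≤ n, X k ω = X k ω') → ω ∈ E → ω' ∈ E

/-- The initial segment of a trajectory. -/
def history (X : ℕ → Ω → V) (n : ℕ) (ω : Ω) : Fin (n + 1) → V := fun k => X k ω

variable {X : ℕ → Ω → V} {n : ℕ} {E F : Set Ω}

theorem IsPast.inter (hE : IsPast X n E) (hF : IsPast X n F) : IsPast X n (E ∩ F) :=
  fun ω ω' h hω => ⟨hE ω ω' h hω.1, hF ω ω' h hω.2⟩

theorem IsPast.mono {m : ℕ} (hE : IsPast X n E) (h : n ≤ m) : IsPast X m E :=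
  fun ω ω' h' => hE ω ω' fun k hk => h' k (hk.trans h)

theorem isPast_eq {k : ℕ} (hk : k ≤ n) (v : V) : IsPast X n {ω | X k ω = v} :=
  fun ω ω' h hω => by
    have h1 := h k hk
    have h2 : X k ω = v := hω
    exact h1.symm.trans h2

theorem IsPast.eq_preimage (hE : IsPast X n E) : E = history X n ⁻¹' (history X n '' E) := by
  refine Set.Subset.antisymm (Set.subset_preimage_image _ _) ?_
  rintro ω ⟨ω', hω', h⟩
  refine hE ω' ω (fun k hk => ?_) hω'
  exact congrFun h ⟨k, by omega⟩

theorem history_preimage_singleton (t : ℕ → V) :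
    history X n ⁻¹' {fun k : Fin (n + 1) => t k} = {ω | ∀ k ≤ n, X k ω = t k} := by
  ext ω
  simp only [Set.mem_preimage, Set.mem_singleton_iff, Set.mem_ofPred_eq, funext_iff, history]
  exact ⟨fun h k hk => h ⟨k, by omega⟩, fun h k => h k (by omega)⟩

theorem exists_extend_history [Nonempty V] (t : Fin (n + 1) → V) :
    ∃ t' : ℕ → V, t = fun k : Fin (n + 1) => t' k := by
  classical
  exact ⟨fun k => if h : k < n + 1 then t ⟨k, h⟩ else Classical.arbitrary V, by
    funext k; simp [Nat.not_lt.2 (Nat.le_of_lt_succ k.2)]⟩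

theorem IsPast.exists_measurable_preimage [MeasurableSpace V] [Countable V]
    [MeasurableSingletonClass V] (hE : IsPast X n E) :
    ∃ T : Set (ℕ → V), MeasurableSet T ∧ E = (fun ω k => X k ω) ⁻¹' T := by
  refine ⟨(fun (x : ℕ → V) (k : Fin (n + 1)) => x k) ⁻¹' (history X n '' E), ?_, hE.eq_preimage⟩
  exact (measurable_pi_lambda _ fun k => measurable_pi_apply _) (Set.to_countable _).measurableSet

variable [MeasurableSpace V] [MeasurableSpace Ω]

theorem measurable_history (hX : ∀ n, Measurable (X n)) : Measurable (history X n) :=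
  measurable_pi_lambda _ fun k => hX k

variable [Countable V] [MeasurableSingletonClass V]

/-- A finite history ranges over a countable set, so every set of histories is measurable and past
events need no separate measurability assumption. -/
theorem IsPast.measurableSet (hX : ∀ n, Measurable (X n)) (hE : IsPast X n E) :
    MeasurableSet E := by
  rw [hE.eq_preimage]
  exact measurable_history hX (Set.to_countable _).measurableSet

/-- An inequality between measures may be checked on the atoms of the history. -/
theorem measure_le_of_history_atoms {μ ν : Measure Ω} (hX : ∀ n, Measurable (X n))
    (hE : IsPast X n E)
    (h : ∀ t : ℕ → V, {ω | ∀ k ≤ n, X k ω = t k} ⊆ E →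
      μ {ω | ∀ k ≤ n, X k ω = t k} ≤ ν {ω | ∀ k ≤ n, X k ω = t k}) : μ E ≤ ν E := by
  rcases isEmpty_or_nonempty V with hV | hV
  · have : IsEmpty Ω := ⟨fun ω => hV.elim (X 0 ω)⟩
    rw [Set.eq_empty_of_isEmpty E]; simp
  have hm := measurable_history (n := n) hX
  have hc : (history X n '' E).Countable := Set.to_countable _
  rw [hE.eq_preimage,
    ← tsum_measure_preimage_singleton hc fun t _ => hm (measurableSet_singleton t),
    ← tsum_measure_preimage_singleton hc fun t _ => hm (measurableSet_singleton t)]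
  refine ENNReal.tsum_le_tsum ?_
  rintro ⟨t, ω₀, hω₀, rfl⟩
  obtain ⟨t', ht'⟩ := exists_extend_history (history X n ω₀)
  dsimp only
  rw [ht', history_preimage_singleton]
  refine h t' fun ω hω => hE ω₀ ω (fun k hk => ?_) hω₀
  have h1 : X k ω = t' k := hω k hk
  have h2 : X k ω₀ = t' k := congrFun ht' ⟨k, by omega⟩
  rw [h1, h2]

theorem measure_eq_of_history_atoms {μ ν : Measure Ω} (hX : ∀ n, Measurable (X n))
    (hE : IsPast X n E)
    (h : ∀ t : ℕ → V, {ω | ∀ k ≤ n, X k ω = t k} ⊆ E →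
      μ {ω | ∀ k ≤ n, X k ω = t k} = ν {ω | ∀ k ≤ n, X k ω = t k}) : μ E = ν E :=
  le_antisymm (measure_le_of_history_atoms hX hE fun t ht => (h t ht).le)
    (measure_le_of_history_atoms hX hE fun t ht => (h t ht).ge)

/-- An event determined by the process whose conditional probability given the past is always
bounded below has probability one. -/
theorem measure_eq_zero_of_history_atoms {P : Measure Ω} [IsProbabilityMeasure P]
    (hX : ∀ n, Measurable (X n)) {A : Set (ℕ → V)} (hA : MeasurableSet A) {δ : ℝ} (hδ : 0 < δ)
    (h : ∀ (n : ℕ) (t : ℕ → V), δ * P.real {ω | ∀ k ≤ n, X k ω = t k} ≤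
      P.real ({ω | ∀ k ≤ n, X k ω = t k} ∩ (fun ω k => X k ω) ⁻¹' A)) :
    P ((fun ω k => X k ω) ⁻¹' Aᶜ) = 0 := by
  set path : Ω → ℕ → V := fun ω k => X k ω with hpath
  have hm : Measurable path := measurable_pi_lambda _ hX
  have hmA : MeasurableSet (path ⁻¹' A) := hm hA
  -- The lower bound passes from single histories to every past event by countable additivity.
  have hpast : ∀ n E, IsPast X n E → δ * P.real E ≤ P.real (E ∩ path ⁻¹' A) := by
    intro n E hE
    have := measure_le_of_history_atoms (μ := ENNReal.ofReal δ • P)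
      (ν := P.restrict (path ⁻¹' A)) hX hE (fun t _ => by
        rw [Measure.restrict_apply' hmA, Measure.smul_apply, smul_eq_mul,
          ← ENNReal.ofReal_toReal (measure_ne_top P {ω | ∀ k ≤ n, X k ω = t k}),
          ← ENNReal.ofReal_toReal (measure_ne_top P ({ω | ∀ k ≤ n, X k ω = t k} ∩ path ⁻¹' A)),
          ← ENNReal.ofReal_mul hδ.le]
        exact ENNReal.ofReal_le_ofReal (h n t))
    rw [Measure.restrict_apply' hmA, Measure.smul_apply, smul_eq_mul] at this
    have := ENNReal.toReal_mono (measure_ne_top _ _) this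
    rwa [ENNReal.toReal_mul, ENNReal.toReal_ofReal hδ.le] at this
  set Q := P.map path
  have hQ : IsProbabilityMeasure Q := Measure.isProbabilityMeasure_map hm.aemeasurable
  have key : ∀ ε : ℝ, 0 < ε → δ * P.real (path ⁻¹' Aᶜ) ≤ (δ + 1) * ε := by
    intro ε hε
    -- The complement of `A` is approximated by a cylinder `T`, whose preimage is a past event. Then
    -- $\delta P(T) \le P(T \cap A) \le \varepsilon$, because $T \cap A$ lies in the symmetric
    -- difference, so $A^c$ is small as well.
    obtain ⟨T, hT, hTA⟩ := exists_measure_symmDiff_lt_of_generateFrom_isSetRing (μ := Q)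
      (C := measurableCylinders fun _ : ℕ => V) isSetRing_measurableCylinders
      ⟨{Set.univ}, Set.countable_singleton _, by
        simpa using univ_mem_measurableCylinders (fun _ : ℕ => V), by simp⟩
      generateFrom_measurableCylinders.symm hA.compl (ENNReal.ofReal_pos.2 hε)
    obtain ⟨s, S, hS, rfl⟩ := (mem_measurableCylinders T).1 hT
    have hTm : MeasurableSet (cylinder s S) := MeasurableSet.of_mem_measurableCylinders (α := fun _ : ℕ => V) hT
    set E := path ⁻¹' cylinder s S
    have hE : IsPast X (s.sup id) E := by
      intro ω ω' hω hωE
      have : s.restrict (path ω') = s.restrict (path ω) := by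
        funext k
        exact (hω k (Finset.le_sup (f := id) k.2)).symm
      change s.restrict (path ω') ∈ S
      rw [this]; exact hωE
    have h1 := hpast _ E hE
    rw [Measure.map_apply hm (hTm.symmDiff hA.compl)] at hTA
    have h2 : P.real (path ⁻¹' symmDiff (cylinder s S) Aᶜ) ≤ ε := by
      have := ENNReal.toReal_mono ENNReal.ofReal_ne_top hTA.le
      rwa [ENNReal.toReal_ofReal hε.le] at this
    have h3 : P.real (E ∩ path ⁻¹' A) ≤ ε := by
      refine le_trans (measureReal_mono ?_) h2
      rintro ω ⟨ha, hb⟩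
      exact Or.inl ⟨ha, fun hc => hc hb⟩
    have h4 : P.real (path ⁻¹' Aᶜ) ≤ P.real E + ε := by
      refine le_trans (measureReal_mono (s₂ := E ∪ path ⁻¹' symmDiff (cylinder s S) Aᶜ) ?_)
        ((measureReal_union_le _ _).trans (by linarith))
      intro ω hω
      by_cases hωE : ω ∈ E
      · exact Or.inl hωE
      · exact Or.inr (Or.inr ⟨hω, hωE⟩)
    nlinarith
  have hle : δ * P.real (path ⁻¹' Aᶜ) ≤ 0 := by
    refine le_of_forall_pos_le_add fun ε hε => ?_
    have := key (ε / (δ + 1)) (by positivity)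
    rw [mul_div_cancel₀ _ (by positivity)] at this
    linarith
  have h0 : P.real (path ⁻¹' Aᶜ) = 0 := by
    have := measureReal_nonneg (μ := P) (s := path ⁻¹' Aᶜ)
    nlinarith
  exact (measureReal_eq_zero_iff (measure_ne_top _ _)).1 h0

end ProcessHistory

/-! ### The Markov property of the simple random walk -/

section RandomWalk

variable {V Ω : Type*} [MeasurableSpace V] [MeasurableSpace Ω] [Countable V]
  [MeasurableSingletonClass V] {G : SimpleGraph V} [G.LocallyFinite] {o : V} {P : Measure Ω}
  [IsProbabilityMeasure P] {X : ℕ → Ω → V}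

theorem srwStep_nonneg {V : Type*} {G : SimpleGraph V} [G.LocallyFinite] (x y : V) : 0 ≤ srwStep G x y := by
  unfold srwStep; split_ifs <;> positivity

/-- The defining property concerns complete trajectories. Summing it over the histories that make up
the event, all of which end at `v`, gives the Markov property for arbitrary past events. -/
theorem IsSimpleRandomWalk.real_step (hX : IsSimpleRandomWalk G o P X) {n : ℕ} {E : Set Ω}
    (hE : IsPast X n E) (v y : V) :
    P.real (E ∩ {ω | X n ω = v} ∩ {ω | X (n + 1) ω = y}) =
      P.real (E ∩ {ω | X n ω = v}) * srwStep G v y := by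
  have hmy : MeasurableSet {ω | X (n + 1) ω = y} := hX.measurable _ (measurableSet_singleton y)
  have := measure_eq_of_history_atoms (μ := P.restrict {ω | X (n + 1) ω = y})
    (ν := ENNReal.ofReal (srwStep G v y) • P) hX.measurable
    (hE.inter (isPast_eq le_rfl v)) (fun t ht => by
      have hm := hX.markov n t y
      rcases Set.eq_empty_or_nonempty {ω | ∀ k ≤ n, X k ω = t k} with h | ⟨ω, hω⟩
      · rw [h]; simp
      have hv : t n = v := (hω n le_rfl).symm.trans (ht hω).2
      rw [Measure.restrict_apply' hmy, Measure.smul_apply, smul_eq_mul,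
        ← ENNReal.ofReal_toReal (measure_ne_top P {ω | ∀ k ≤ n, X k ω = t k}),
        ← ENNReal.ofReal_toReal (measure_ne_top P
          ({ω | ∀ k ≤ n, X k ω = t k} ∩ {ω | X (n + 1) ω = y})),
        ← ENNReal.ofReal_mul (srwStep_nonneg _ _)]
      congr 1
      rw [mul_comm, ← hv]
      exact hm)
  rw [Measure.restrict_apply' hmy, Measure.smul_apply, smul_eq_mul] at this
  rw [measureReal_def, this, ENNReal.toReal_mul, ENNReal.toReal_ofReal (srwStep_nonneg _ _),
    mul_comm]
  rfl

theorem measureReal_eq_tsum_fiber {Y : Ω → V} (hY : Measurable Y) (A : Set Ω) : P.real A = ∑' u, P.real (A ∩ {ω | Y ω = u}) := by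
  have h := tsum_measure_preimage_singleton (μ := P.restrict A) (s := Set.univ) (f := Y)
    (Set.to_countable _) (fun y _ => hY (measurableSet_singleton y))
  rw [tsum_univ (f := fun b => P.restrict A (Y ⁻¹' {b}))] at h
  have e : ∀ u, P.restrict A (Y ⁻¹' {u}) = P (A ∩ {ω | Y ω = u}) := fun u => by
    rw [Measure.restrict_apply (hY (measurableSet_singleton u)), Set.inter_comm]; rfl
  simp only [e, Set.preimage_univ, Measure.restrict_apply_univ] at h
  rw [measureReal_def, ← h, ENNReal.tsum_toReal_eq fun u => measure_ne_top _ _]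
  rfl

/-- The Markov property: transition probabilities over several steps. -/
theorem IsSimpleRandomWalk.real_heat (hX : IsSimpleRandomWalk G o P X) (j : ℕ) {n : ℕ} {E : Set Ω}
    (hE : IsPast X n E) (v w : V) :
    P.real (E ∩ {ω | X n ω = v} ∩ {ω | X (n + j) ω = w}) =
      P.real (E ∩ {ω | X n ω = v}) * heat G j v w := by
  induction j generalizing n E v with
  | zero =>
    by_cases h : v = w
    · subst h
      rw [heat_zero_self, mul_one, Set.inter_assoc]; simp
    · have : E ∩ {ω | X n ω = v} ∩ {ω | X (n + 0) ω = w} = ∅ := by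
        ext ω
        simp only [Set.mem_inter_iff, Set.mem_ofPred_eq, add_zero, Set.mem_empty_iff_false, iff_false]
        rintro ⟨⟨-, h1⟩, h2⟩
        exact h (h1.symm.trans h2)
      rw [this]
      simp [heat, pointMass, h]
  | succ j ih =>
    have hpast : IsPast X (n + 1) (E ∩ {ω | X n ω = v}) :=
      (hE.inter (isPast_eq le_rfl v)).mono (Nat.le_succ n)
    rw [measureReal_eq_tsum_fiber (hX.measurable (n + 1))]
    have e : ∀ u, P.real (E ∩ {ω | X n ω = v} ∩ {ω | X (n + (j + 1)) ω = w} ∩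
        {ω | X (n + 1) ω = u}) = P.real (E ∩ {ω | X n ω = v}) * (srwStep G v u * heat G j u w) := by
      intro u
      rw [Set.inter_right_comm, show n + (j + 1) = n + 1 + j by ring, ih hpast, hX.real_step hE,
        mul_assoc]
    simp only [e]
    rw [tsum_mul_left]
    congr 1
    rw [tsum_eq_sum (s := G.neighborFinset v)]
    · unfold heat
      rw [Function.iterate_succ_apply']
      unfold avg
      rw [Finset.sum_div]
      refine Finset.sum_congr rfl fun u hu => ?_
      rw [srwStep, if_pos (by simpa using hu)]
      ring
    · intro u hu
      rw [srwStep, if_neg (by simpa using hu), zero_mul]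

theorem IsSimpleRandomWalk.heat_pos_of_real_pos (hX : IsSimpleRandomWalk G o P X) {n : ℕ} {v : V}
    (h : 0 < P.real {ω | X n ω = v}) : 0 < heat G n o v := by
  have h1 := hX.real_heat n (n := 0) (E := Set.univ) (fun _ _ _ _ => trivial) o v
  have h0 : P.real {ω | X 0 ω = o} = 1 := by
    rw [← probReal_univ (μ := P)]
    exact measureReal_congr (by
      filter_upwards [hX.start] with ω hω
      exact propext ⟨fun _ => trivial, fun _ => hω⟩)
  rw [Set.univ_inter, h0, one_mul, zero_add] at h1
  rw [← h1]
  refine h.trans_le (le_of_eq (measureReal_congr ?_))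
  filter_upwards [hX.start] with ω hω
  exact propext ⟨fun h => ⟨hω, h⟩, fun h => h.2⟩

end RandomWalk

/-! ### The second moment inequality -/

section SecondMoment

/-- A Paley-Zygmund inequality. -/
theorem paley_zygmund {Ω : Type*} [MeasurableSpace Ω] {μ : Measure Ω} [IsFiniteMeasure μ]
    {K : Ω → ℝ} (hK : Measurable K) {b : ℝ} (hKb : ∀ ω, |K ω| ≤ b) {M U : ℝ}
    (hM : 0 ≤ M) (hU : 0 < U) (h1 : ∫ ω, K ω ∂μ = M * μ.real Set.univ)
    (h2 : ∫ ω, K ω ^ 2 ∂μ ≤ 2 * U * (M * μ.real Set.univ)) :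
    M / (8 * U) * μ.real Set.univ ≤ μ.real {ω | M / 2 ≤ K ω} := by
  set S := {ω | M / 2 ≤ K ω}
  have hS : MeasurableSet S := measurableSet_le measurable_const hK
  have i1 : Integrable K μ := Integrable.of_bound hK.aestronglyMeasurable b (ae_of_all _ hKb)
  have i2 : Integrable (fun ω => K ω ^ 2) μ :=
    Integrable.of_bound (hK.pow_const 2).aestronglyMeasurable (b ^ 2) (ae_of_all _ fun ω => by
      rw [Real.norm_eq_abs, abs_pow]
      exact pow_le_pow_left₀ (abs_nonneg _) (hKb ω) 2)
  have i3 : Integrable (S.indicator fun _ => (1 : ℝ)) μ := (integrable_const 1).indicator hS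
  -- Where $K \ge M/2$, the arithmetic–geometric mean inequality gives $K \le K^2/(8U) + 2U$. On
  -- integration the quadratic term costs at most a quarter of the mean and $M/2$ costs half, which
  -- leaves a quarter for the event.
  have hpt : ∀ ω, K ω ≤ M / 2 + (1 / (8 * U) * K ω ^ 2 +
      2 * U * S.indicator (fun _ => (1 : ℝ)) ω) := by
    intro ω
    have hsq : 0 ≤ 1 / (8 * U) * K ω ^ 2 := by positivity
    by_cases hω : ω ∈ S
    · have hω' : M / 2 ≤ K ω := hω
      rw [Set.indicator_of_mem hω]
      have : K ω ≤ 1 / (8 * U) * K ω ^ 2 + 2 * U := by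
        rw [one_div_mul_eq_div, ← sub_nonneg]
        have e : K ω ^ 2 / (8 * U) + 2 * U - K ω = ((K ω - 4 * U) ^ 2) / (8 * U) := by
          field_simp; ring
        rw [e]; positivity
      linarith
    · have hω' : K ω < M / 2 := not_le.1 hω
      rw [Set.indicator_of_notMem hω]
      linarith
  have i4 : Integrable (fun ω => 1 / (8 * U) * K ω ^ 2 +
      2 * U * S.indicator (fun _ => (1 : ℝ)) ω) μ := (i2.const_mul _).add (i3.const_mul _)
  have hint := integral_mono i1 ((integrable_const (M / 2)).add i4) hpt
  simp only [Pi.add_apply] at hint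
  rw [integral_add (integrable_const (M / 2)) i4, integral_add (i2.const_mul _) (i3.const_mul _),
    integral_const_mul, integral_const_mul, integral_indicator_const _ hS, integral_const, h1]
    at hint
  simp only [smul_eq_mul, mul_one] at hint
  have h3 : 1 / (8 * U) * ∫ ω, K ω ^ 2 ∂μ ≤ M * μ.real Set.univ / 4 := by
    rw [one_div_mul_eq_div, div_le_iff₀ (by positivity)]
    linarith
  rw [div_mul_eq_mul_div, div_le_iff₀ (by positivity)]
  linarith

end SecondMoment

/-! ### Moments of the number of triple collisions after a given history -/

section TripleCollisions

variable {V Ω : Type*} {X Y Z : ℕ → Ω → V}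

/-- A symmetric double sum is at most twice its upper triangular part. -/
theorem sum_sum_le_two_mul {ι : Type*} (I : Finset ι) (τ : ι → ℕ) (c : ι → ι → ℝ)
    (hc : ∀ i j, 0 ≤ c i j) (hsymm : ∀ i j, c i j = c j i) :
    ∑ i ∈ I, ∑ j ∈ I, c i j ≤ 2 * ∑ i ∈ I, ∑ j ∈ I, if τ i ≤ τ j then c i j else 0 := by
  have h1 : ∑ i ∈ I, ∑ j ∈ I, c i j ≤ ∑ i ∈ I, ∑ j ∈ I,
      ((if τ i ≤ τ j then c i j else 0) + (if τ j ≤ τ i then c j i else 0)) := by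
    refine Finset.sum_le_sum fun i _ => Finset.sum_le_sum fun j _ => ?_
    have := hc i j
    have := hc j i
    rcases le_total (τ i) (τ j) with h | h
    · rw [if_pos h]; split_ifs <;> linarith
    · rw [if_pos h, hsymm i j]; split_ifs <;> linarith
  refine h1.trans (le_of_eq ?_)
  simp only [Finset.sum_add_distrib]
  rw [Finset.sum_comm (f := fun i j => if τ j ≤ τ i then c j i else 0), two_mul]

/-- The walks are all at `w` at time `n`. -/
def meetAt (X Y Z : ℕ → Ω → V) (n : ℕ) (w : V) : Set Ω :=
  {ω | X n ω = w} ∩ {ω | Y n ω = w} ∩ {ω | Z n ω = w}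

/-- The three walks follow prescribed trajectories up to time `m`. -/
def jointHistory (X Y Z : ℕ → Ω → V) (m : ℕ) (x y z : ℕ → V) : Set Ω :=
  {ω | ∀ k ≤ m, X k ω = x k} ∩ {ω | ∀ k ≤ m, Y k ω = y k} ∩ {ω | ∀ k ≤ m, Z k ω = z k}

theorem isPast_history (m : ℕ) (x : ℕ → V) : IsPast X m {ω | ∀ k ≤ m, X k ω = x k} :=
  fun _ _ h hω k hk => (h k hk).symm.trans (hω k hk)

theorem history_inter_self (m : ℕ) (x : ℕ → V) :
    {ω | ∀ k ≤ m, X k ω = x k} ∩ {ω | X m ω = x m} = {ω | ∀ k ≤ m, X k ω = x k} :=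
  Set.inter_eq_left.2 fun _ hω => hω m le_rfl

/-- At each time there is at most one meeting vertex, so pairs (time, vertex) inject into collision
times. Starting at offset 1 keeps time 0 out even when $m = 0$; the bound on $m + T$ keeps all times
at most `N`. -/
theorem sum_meetAt_le_tripleCollisions {m T N : ℕ} (hT : m + T ≤ N + 1) (S : Finset V) (ω : Ω) :
    ∑ i ∈ Finset.Ico 1 T ×ˢ S, (meetAt X Y Z (m + i.1) i.2).indicator (fun _ => (1 : ℝ)) ω ≤
      tripleCollisions (fun n => X n ω) (fun n => Y n ω) (fun n => Z n ω) N := by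
  classical
  have e : ∀ i : ℕ × V, (meetAt X Y Z (m + i.1) i.2).indicator (fun _ => (1 : ℝ)) ω =
      if ω ∈ meetAt X Y Z (m + i.1) i.2 then 1 else 0 := fun i => by
    rw [Set.indicator_apply]
  simp only [e]
  rw [Finset.sum_boole]
  unfold tripleCollisions
  rw [Nat.cast_le]
  refine Finset.card_le_card_of_injOn (fun i => m + i.1) ?_ ?_
  · intro i hi
    simp only [Finset.coe_filter, Finset.mem_product, Finset.mem_Ico, Set.mem_ofPred_eq] at hi
    obtain ⟨⟨⟨h1, h2⟩, -⟩, ⟨h3, h4⟩, h5⟩ := hi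
    simp only [Finset.coe_filter, Finset.mem_Icc, Set.mem_ofPred_eq]
    have h3' : X (m + i.1) ω = i.2 := h3
    have h4' : Y (m + i.1) ω = i.2 := h4
    have h5' : Z (m + i.1) ω = i.2 := h5
    exact ⟨⟨by omega, by omega⟩, h3'.trans h4'.symm, h4'.trans h5'.symm⟩
  · intro i hi j hj hij
    simp only [Finset.coe_filter, Set.mem_ofPred_eq] at hi hj
    have h1 : i.1 = j.1 := by dsimp only at hij; omega
    have h2 : X (m + i.1) ω = i.2 := hi.2.1.1
    have h3 : X (m + j.1) ω = j.2 := hj.2.1.1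
    exact Prod.ext h1 (by rw [← h2, ← h3, h1])

variable [MeasurableSpace V] [MeasurableSpace Ω] [MeasurableSingletonClass V]

theorem measurableSet_meetAt (hX : ∀ n, Measurable (X n)) (hY : ∀ n, Measurable (Y n))
    (hZ : ∀ n, Measurable (Z n)) (n : ℕ) (w : V) : MeasurableSet (meetAt X Y Z n w) :=
  ((hX n (measurableSet_singleton w)).inter (hY n (measurableSet_singleton w))).inter
    (hZ n (measurableSet_singleton w))

variable [Countable V]

theorem measurableSet_jointHistory (hX : ∀ n, Measurable (X n)) (hY : ∀ n, Measurable (Y n))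
    (hZ : ∀ n, Measurable (Z n)) (m : ℕ) (x y z : ℕ → V) :
    MeasurableSet (jointHistory X Y Z m x y z) :=
  (((isPast_history m x).measurableSet hX).inter ((isPast_history m y).measurableSet hY)).inter
    ((isPast_history m z).measurableSet hZ)

variable {G : SimpleGraph V} [G.LocallyFinite] {o : V} {P : Measure Ω} [IsProbabilityMeasure P]

/-- Past events are preimages of measurable sets of trajectories, so independence of the three
trajectories as random elements of path space applies. -/
theorem real_inter_of_iIndepFun {P : Measure Ω}
    (hindep : iIndepFun ![fun ω n => X n ω, fun ω n => Y n ω, fun ω n => Z n ω] P) {n : ℕ}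
    {A B C : Set Ω} (hA : IsPast X n A) (hB : IsPast Y n B) (hC : IsPast Z n C) :
    P.real (A ∩ B ∩ C) = P.real A * P.real B * P.real C := by
  obtain ⟨A', hA', rfl⟩ := hA.exists_measurable_preimage
  obtain ⟨B', hB', rfl⟩ := hB.exists_measurable_preimage
  obtain ⟨C', hC', rfl⟩ := hC.exists_measurable_preimage
  have h := hindep.measure_inter_preimage_eq_mul Finset.univ (sets := ![A', B', C'])
    (fun i _ => by fin_cases i <;> assumption)
  rw [Fin.prod_univ_three] at h
  simp only [measureReal_def, ← ENNReal.toReal_mul]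
  congr 1
  refine Eq.trans (congrArg P ?_) h
  ext ω
  simp [Fin.forall_fin_succ, and_assoc]

theorem IsSimpleRandomWalk.real_history_inter (hX : IsSimpleRandomWalk G o P X) (m j : ℕ)
    (x : ℕ → V) (w : V) : P.real ({ω | ∀ k ≤ m, X k ω = x k} ∩ {ω | X (m + j) ω = w}) =
      P.real {ω | ∀ k ≤ m, X k ω = x k} * heat G j (x m) w := by
  have := hX.real_heat j (isPast_history m x) (x m) w
  rwa [history_inter_self] at this

theorem IsSimpleRandomWalk.real_history_inter_inter (hX : IsSimpleRandomWalk G o P X) (m i j : ℕ)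
    (x : ℕ → V) (v w : V) : P.real ({ω | ∀ k ≤ m, X k ω = x k} ∩ {ω | X (m + i) ω = v} ∩
      {ω | X (m + i + j) ω = w}) =
      P.real ({ω | ∀ k ≤ m, X k ω = x k} ∩ {ω | X (m + i) ω = v}) * heat G j v w :=
  hX.real_heat j ((isPast_history m x).mono (Nat.le_add_right m i)) v w

theorem real_jointHistory_meetAt (hX : IsSimpleRandomWalk G o P X)
    (hY : IsSimpleRandomWalk G o P Y) (hZ : IsSimpleRandomWalk G o P Z)
    (hindep : iIndepFun ![fun ω n => X n ω, fun ω n => Y n ω, fun ω n => Z n ω] P)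
    (m j : ℕ) (x y z : ℕ → V) (w : V) :
    P.real (jointHistory X Y Z m x y z ∩ meetAt X Y Z (m + j) w) =
      P.real (jointHistory X Y Z m x y z) *
        (heat G j (x m) w * heat G j (y m) w * heat G j (z m) w) := by
  have e : jointHistory X Y Z m x y z ∩ meetAt X Y Z (m + j) w =
      ({ω | ∀ k ≤ m, X k ω = x k} ∩ {ω | X (m + j) ω = w}) ∩
      ({ω | ∀ k ≤ m, Y k ω = y k} ∩ {ω | Y (m + j) ω = w}) ∩
      ({ω | ∀ k ≤ m, Z k ω = z k} ∩ {ω | Z (m + j) ω = w}) := by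
    unfold jointHistory meetAt; ext ω; simp only [Set.mem_inter_iff]; tauto
  have hp : ∀ (W : ℕ → Ω → V) (t : ℕ → V),
      IsPast W (m + j) ({ω | ∀ k ≤ m, W k ω = t k} ∩ {ω | W (m + j) ω = w}) := fun W t =>
    ((isPast_history m t).mono (Nat.le_add_right m j)).inter (isPast_eq le_rfl w)
  rw [e, real_inter_of_iIndepFun hindep (hp X x) (hp Y y) (hp Z z), hX.real_history_inter,
    hY.real_history_inter, hZ.real_history_inter, jointHistory,
    real_inter_of_iIndepFun hindep (isPast_history m x) (isPast_history m y) (isPast_history m z)]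
  ring

theorem real_jointHistory_meetAt_meetAt (hX : IsSimpleRandomWalk G o P X)
    (hY : IsSimpleRandomWalk G o P Y) (hZ : IsSimpleRandomWalk G o P Z)
    (hindep : iIndepFun ![fun ω n => X n ω, fun ω n => Y n ω, fun ω n => Z n ω] P)
    (m i j : ℕ) (x y z : ℕ → V) (v w : V) :
    P.real (jointHistory X Y Z m x y z ∩ meetAt X Y Z (m + i) v ∩ meetAt X Y Z (m + i + j) w) =
      P.real (jointHistory X Y Z m x y z ∩ meetAt X Y Z (m + i) v) * heat G j v w ^ 3 := by
  have e : jointHistory X Y Z m x y z ∩ meetAt X Y Z (m + i) v ∩ meetAt X Y Z (m + i + j) w =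
      ({ω | ∀ k ≤ m, X k ω = x k} ∩ {ω | X (m + i) ω = v} ∩ {ω | X (m + i + j) ω = w}) ∩
      ({ω | ∀ k ≤ m, Y k ω = y k} ∩ {ω | Y (m + i) ω = v} ∩ {ω | Y (m + i + j) ω = w}) ∩
      ({ω | ∀ k ≤ m, Z k ω = z k} ∩ {ω | Z (m + i) ω = v} ∩ {ω | Z (m + i + j) ω = w}) := by
    unfold jointHistory meetAt; ext ω; simp only [Set.mem_inter_iff]; tauto
  have hp : ∀ (W : ℕ → Ω → V) (t : ℕ → V), IsPast W (m + i + j)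
      ({ω | ∀ k ≤ m, W k ω = t k} ∩ {ω | W (m + i) ω = v} ∩ {ω | W (m + i + j) ω = w}) :=
    fun W t => (((isPast_history m t).mono (by omega)).inter (isPast_eq (by omega) v)).inter
      (isPast_eq le_rfl w)
  rw [e, real_inter_of_iIndepFun hindep (hp X x) (hp Y y) (hp Z z), hX.real_history_inter_inter,
    hY.real_history_inter_inter, hZ.real_history_inter_inter,
    real_jointHistory_meetAt hX hY hZ hindep, jointHistory,
    real_inter_of_iIndepFun hindep (isPast_history m x) (isPast_history m y) (isPast_history m z),
    hX.real_history_inter, hY.real_history_inter, hZ.real_history_inter]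
  ring

/-- Second moment lower bound for the conditional probability of many triple collisions. -/
theorem real_many_collisions_ge (hX : IsSimpleRandomWalk G o P X)
    (hY : IsSimpleRandomWalk G o P Y) (hZ : IsSimpleRandomWalk G o P Z)
    (hindep : iIndepFun ![fun ω n => X n ω, fun ω n => Y n ω, fun ω n => Z n ω] P)
    {m T N : ℕ} (hT : m + T ≤ N + 1) (x y z : ℕ → V) (S : Finset V) {U M : ℝ} (hU : 0 < U)
    (hSU : ∀ w ∈ S, ∑ k ∈ Finset.range T, ∑ w' ∈ S, heat G k w w' ^ 3 ≤ U)
    (hM : M = ∑ j ∈ Finset.Ico 1 T, ∑ w ∈ S, heat G j (x m) w * heat G j (y m) w * heat G j (z m) w) :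
    M / (8 * U) * P.real (jointHistory X Y Z m x y z) ≤
      P.real (jointHistory X Y Z m x y z ∩ {ω | M / 2 ≤
        tripleCollisions (fun n => X n ω) (fun n => Y n ω) (fun n => Z n ω) N}) := by
  set a := jointHistory X Y Z m x y z with ha
  have hma : MeasurableSet a :=
    measurableSet_jointHistory hX.measurable hY.measurable hZ.measurable m x y z
  set E : ℕ × V → Set Ω := fun i => meetAt X Y Z (m + i.1) i.2 with hE
  have hmE : ∀ i, MeasurableSet (E i) := fun i =>
    measurableSet_meetAt hX.measurable hY.measurable hZ.measurable _ _
  set I := Finset.Ico 1 T ×ˢ S with hI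
  set K : Ω → ℝ := fun ω => ∑ i ∈ I, (E i).indicator (fun _ => (1 : ℝ)) ω with hK
  have hmK : Measurable K := Finset.measurable_sum _ fun i _ => measurable_const.indicator (hmE i)
  have hK0 : ∀ ω, 0 ≤ K ω := fun ω => Finset.sum_nonneg fun i _ =>
    Set.indicator_nonneg (fun _ _ => zero_le_one) ω
  have hKb : ∀ ω, |K ω| ≤ I.card := fun ω => by
    rw [abs_of_nonneg (hK0 ω)]
    have := Finset.sum_le_card_nsmul I (fun i => (E i).indicator (fun _ => (1 : ℝ)) ω) 1
      (fun i _ => Set.indicator_apply_le' (fun _ => le_rfl) fun _ => zero_le_one)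
    simpa using this
  set μ := P.restrict a
  have hμu : μ.real Set.univ = P.real a := by simp [μ]
  have hint : ∀ F : Set Ω, MeasurableSet F →
      ∫ ω, F.indicator (fun _ => (1 : ℝ)) ω ∂μ = P.real (a ∩ F) := fun F hF => by
    rw [integral_indicator_const _ hF, smul_eq_mul, mul_one, measureReal_restrict_apply hF,
      Set.inter_comm]
  have hii : ∀ F : Set Ω, MeasurableSet F → Integrable (F.indicator fun _ => (1 : ℝ)) μ :=
    fun F hF => (integrable_const 1).indicator hF
  have hprod : ∀ i, P.real (a ∩ E i) =
      P.real a * (heat G i.1 (x m) i.2 * heat G i.1 (y m) i.2 * heat G i.1 (z m) i.2) := fun i =>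
    real_jointHistory_meetAt hX hY hZ hindep m i.1 x y z i.2
  have hsum : ∑ i ∈ I, P.real (a ∩ E i) = M * P.real a := by
    simp only [hprod]
    rw [← Finset.mul_sum, hI, Finset.sum_product, ← hM, mul_comm]
  have h1 : ∫ ω, K ω ∂μ = M * μ.real Set.univ := by
    rw [hK, integral_finsetSum _ fun i _ => hii _ (hmE i), hμu, ← hsum]
    exact Finset.sum_congr rfl fun i _ => hint _ (hmE i)
  have h2 : ∫ ω, K ω ^ 2 ∂μ ≤ 2 * U * (M * μ.real Set.univ) := by
    have e : ∀ ω, K ω ^ 2 = ∑ i ∈ I, ∑ j ∈ I, (E i ∩ E j).indicator (fun _ => (1 : ℝ)) ω := by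
      intro ω
      rw [sq, hK, Finset.sum_mul_sum]
      refine Finset.sum_congr rfl fun i _ => Finset.sum_congr rfl fun j _ => ?_
      rw [Set.inter_indicator_mul (fun _ => (1 : ℝ)) (fun _ => (1 : ℝ)) ω |>.symm]
      simp
    simp only [e]
    rw [integral_finsetSum _ fun i _ => integrable_finsetSum _ fun j _ =>
      hii _ ((hmE i).inter (hmE j))]
    have e2 : ∀ i ∈ I, ∫ ω, ∑ j ∈ I, (E i ∩ E j).indicator (fun _ => (1 : ℝ)) ω ∂μ =
        ∑ j ∈ I, P.real (a ∩ (E i ∩ E j)) := fun i _ => by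
      rw [integral_finsetSum _ fun j _ => hii _ ((hmE i).inter (hmE j))]
      exact Finset.sum_congr rfl fun j _ => hint _ ((hmE i).inter (hmE j))
    rw [Finset.sum_congr rfl e2]
    -- Pairs are ordered by time. Given the earlier meeting, the walks restart from a common vertex,
    -- and the expected number of later meetings is at most `U`, whatever that vertex is.
    refine (sum_sum_le_two_mul I Prod.fst (fun i j => P.real (a ∩ (E i ∩ E j)))
      (fun i j => measureReal_nonneg) (fun i j => by rw [Set.inter_comm (E i)])).trans ?_
    rw [mul_assoc, hμu, ← hsum]
    refine mul_le_mul_of_nonneg_left ?_ zero_le_two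
    rw [Finset.mul_sum]
    refine Finset.sum_le_sum fun i hi => ?_
    have hi2 : i.2 ∈ S := (Finset.mem_product.1 hi).2
    calc ∑ j ∈ I, (if i.1 ≤ j.1 then P.real (a ∩ (E i ∩ E j)) else 0)
        = ∑ j ∈ Finset.Ico 1 T, ∑ w ∈ S,
          (if i.1 ≤ j then P.real (a ∩ E i) * heat G (j - i.1) i.2 w ^ 3 else 0) := by
          rw [hI, Finset.sum_product]
          refine Finset.sum_congr rfl fun j _ => Finset.sum_congr rfl fun w _ => ?_
          split_ifs with h
          · have := real_jointHistory_meetAt_meetAt hX hY hZ hindep m i.1 (j - i.1) x y z i.2 w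
            rw [show m + i.1 + (j - i.1) = m + j by omega] at this
            rw [← Set.inter_assoc]; exact this
          · rfl
      _ = P.real (a ∩ E i) * ∑ j ∈ (Finset.Ico 1 T).filter (i.1 ≤ ·), ∑ w ∈ S,
          heat G (j - i.1) i.2 w ^ 3 := by
          rw [Finset.sum_filter, Finset.mul_sum]
          refine Finset.sum_congr rfl fun j _ => ?_
          split_ifs
          · rw [Finset.mul_sum]
          · simp
      _ ≤ P.real (a ∩ E i) * ∑ k ∈ Finset.range T, ∑ w ∈ S, heat G k i.2 w ^ 3 := by
          refine mul_le_mul_of_nonneg_left ?_ measureReal_nonneg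
          -- Reindexing by the time lag, which is injective on the times not before the first
          -- meeting.
          rw [← Finset.sum_image (s := (Finset.Ico 1 T).filter (i.1 ≤ ·)) (g := fun j => j - i.1)
            (f := fun k => ∑ w ∈ S, heat G k i.2 w ^ 3)]
          · refine Finset.sum_le_sum_of_subset_of_nonneg ?_ fun k _ _ =>
              Finset.sum_nonneg fun w _ => pow_nonneg (heat_nonneg _ _ _) 3
            intro k hk
            obtain ⟨j, hj, rfl⟩ := Finset.mem_image.1 hk
            rw [Finset.mem_filter, Finset.mem_Ico] at hj
            rw [Finset.mem_range]; omega
          · intro j hj j' hj' h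
            have h1 := (Finset.mem_filter.1 hj).2
            have h2 := (Finset.mem_filter.1 hj').2
            dsimp only at h
            omega
      _ ≤ P.real (a ∩ E i) * U := by
          exact mul_le_mul_of_nonneg_left (hSU _ hi2) measureReal_nonneg
      _ = U * P.real (a ∩ E i) := mul_comm _ _
  have hM0 : 0 ≤ M := hM ▸ Finset.sum_nonneg fun j _ => Finset.sum_nonneg fun w _ =>
    mul_nonneg (mul_nonneg (heat_nonneg _ _ _) (heat_nonneg _ _ _)) (heat_nonneg _ _ _)
  have hpz := paley_zygmund hmK hKb hM0 hU h1 h2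
  rw [hμu] at hpz
  refine hpz.trans ?_
  rw [measureReal_restrict_apply (measurableSet_le measurable_const hmK)]
  refine measureReal_mono ?_
  rintro ω ⟨h3, h4⟩
  exact ⟨h4, le_trans h3 (sum_meetAt_le_tripleCollisions hT S ω)⟩

/-- If events have probability bounded below within `a`, then so has their limit superior. -/
theorem real_inter_frequently_ge {a : Set Ω} (ha : MeasurableSet a) {B : ℕ → Set Ω}
    (hB : ∀ N, MeasurableSet (B N)) {δ : ℝ} (h : ∀ᶠ N in atTop, δ ≤ P.real (a ∩ B N)) :
    δ ≤ P.real (a ∩ {ω | ∃ᶠ N in atTop, ω ∈ B N}) := by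
  have e : a ∩ {ω | ∃ᶠ N in atTop, ω ∈ B N} = ⋂ n : ℕ, ⋃ N ≥ n, a ∩ B N := by
    ext ω
    simp only [Set.mem_inter_iff, Set.mem_ofPred_eq, frequently_atTop, Set.mem_iInter,
      Set.mem_iUnion, exists_prop]
    constructor
    · rintro ⟨h1, h2⟩ n
      obtain ⟨N, hN, h3⟩ := h2 n
      exact ⟨N, hN, h1, h3⟩
    · intro h1
      exact ⟨(h1 0).choose_spec.2.1, fun n => ⟨_, (h1 n).choose_spec.1, (h1 n).choose_spec.2.2⟩⟩
  rw [e]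
  have hm : ∀ n : ℕ, MeasurableSet (⋃ N ≥ n, a ∩ B N) := fun n =>
    MeasurableSet.iUnion fun N => MeasurableSet.iUnion fun _ => ha.inter (hB N)
  have hanti : Antitone fun n : ℕ => ⋃ N ≥ n, a ∩ B N := fun n n' hn =>
    Set.biUnion_subset_biUnion_left fun N (hN : n' ≤ N) => hn.trans hN
  -- Continuity from above: each tail union contains some $a \cap B_N$ of probability at least
  -- $\delta$.
  have ht := tendsto_measure_iInter_atTop (μ := P) (fun n => (hm n).nullMeasurableSet) hanti
    ⟨0, measure_ne_top _ _⟩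
  have ht' := (ENNReal.tendsto_toReal (measure_ne_top _ _)).comp ht
  refine ge_of_tendsto ht' ?_
  filter_upwards [eventually_ge_atTop 0] with n _
  obtain ⟨N, hN, h'⟩ := (h.and (eventually_ge_atTop n)).exists.imp fun N hN => hN.symm
  exact h'.trans (measureReal_mono (Set.subset_biUnion_of_mem (u := fun N => a ∩ B N) hN)
    (measure_ne_top _ _))

end TripleCollisions

/-! ### Uniform lower bound given the history, and conclusion -/

section MainTheorem

theorem measurable_tripleCollisions {V : Type*} [MeasurableSpace V] [Countable V]
    [MeasurableSingletonClass V] (N : ℕ) : Measurable fun p : ℕ → V × V × V =>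
      (tripleCollisions (fun n => (p n).1) (fun n => (p n).2.1) (fun n => (p n).2.2) N : ℝ) := by
  classical
  have e : (fun p : ℕ → V × V × V =>
      (tripleCollisions (fun n => (p n).1) (fun n => (p n).2.1) (fun n => (p n).2.2) N : ℝ)) =
      fun p => ∑ n ∈ Finset.Icc 1 N,
        if p n ∈ {q : V × V × V | q.1 = q.2.1 ∧ q.2.1 = q.2.2} then (1 : ℝ) else 0 := by
    funext p
    rw [Finset.sum_boole]
    unfold tripleCollisions
    congr
  rw [e]
  refine Finset.measurable_sum _ fun n _ => Measurable.ite ?_ measurable_const measurable_const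
  exact measurable_pi_apply n (Set.to_countable _).measurableSet

variable {α : ℝ} {Ω : Type*} [MeasurableSpace Ω] {P : Measure Ω} [IsProbabilityMeasure P]

theorem even_combParity_of_real_pos {X : ℕ → Ω → combLogVertices α}
    (hX : IsSimpleRandomWalk (combLog α) (combLogOrigin α) P X) {n : ℕ} {v : combLogVertices α}
    (h : 0 < P.real {ω | X n ω = v}) : Even (combParity v + n) := by
  by_contra hne
  have h0 := heat_eq_zero_of_parity (G := combLog α) combParity_adj n (combLogOrigin α) v (by
    have : combParity (combLogOrigin α) = 0 := rfl
    rwa [this, zero_add])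
  exact (hX.heat_pos_of_real_pos h).ne' h0

/-- Given any history of the three walks, the number of collisions up to time `N` exceeds a
multiple of `rate α N` with probability bounded below, for all large `N`. -/
theorem exists_eventually_real_collisions_ge (hα0 : 0 ≤ α) (hα1 : α ≤ 1)
    {X Y Z : ℕ → Ω → combLogVertices α}
    (hX : IsSimpleRandomWalk (combLog α) (combLogOrigin α) P X)
    (hY : IsSimpleRandomWalk (combLog α) (combLogOrigin α) P Y)
    (hZ : IsSimpleRandomWalk (combLog α) (combLogOrigin α) P Z)
    (hindep : iIndepFun ![fun ω n => X n ω, fun ω n => Y n ω, fun ω n => Z n ω] P) :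
    ∃ c δ : ℝ, 0 < c ∧ 0 < δ ∧ ∀ (m : ℕ) (x y z : ℕ → combLogVertices α), ∀ᶠ N : ℕ in atTop,
      δ * P.real (jointHistory X Y Z m x y z) ≤
        P.real (jointHistory X Y Z m x y z ∩ {ω | c * rate α N ≤
          tripleCollisions (fun n => X n ω) (fun n => Y n ω) (fun n => Z n ω) N}) := by
  obtain ⟨C, hC, hU⟩ := exists_sum_heat_cube_le hα0 hα1
  -- $1016064 = 2\cdot 508032$, since half of the conditional mean is attained; $\delta$ is the
  -- ratio $M/(8U)$ for $M = \text{rate}/508032$ and $U = C\cdot\text{rate}$.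
  refine ⟨1 / 1016064, 1 / (8 * 508032 * C), by norm_num, by positivity, fun m x y z => ?_⟩
  rcases (measureReal_nonneg (μ := P) (s := jointHistory X Y Z m x y z)).eq_or_lt with h0 | hpos
  · exact Eventually.of_forall fun N => by rw [← h0, mul_zero]; exact measureReal_nonneg
  have px : Even (combParity (x m) + m) := even_combParity_of_real_pos hX
    (hpos.trans_le (measureReal_mono (fun ω hω => hω.1.1 m le_rfl)))
  have py : Even (combParity (y m) + m) := even_combParity_of_real_pos hY
    (hpos.trans_le (measureReal_mono (fun ω hω => hω.1.2 m le_rfl)))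
  have pz : Even (combParity (z m) + m) := even_combParity_of_real_pos hZ
    (hpos.trans_le (measureReal_mono (fun ω hω => hω.2 m le_rfl)))
  -- In a history of positive probability the three walks share the parity of the time; for other
  -- parities no collision could occur.
  have pxy : Even (combParity (x m) + combParity (y m)) := by
    rw [Int.even_iff] at *; omega
  have pxz : Even (combParity (x m) + combParity (z m)) := by
    rw [Int.even_iff] at *; omega
  filter_upwards [hU, eventually_sum_heat_ge hα0 hα1 pxy pxz m, eventually_ge_atTop m,
    tendsto_rate.eventually_gt_atTop 0] with N h1 h2 h3 h4
  have h := real_many_collisions_ge hX hY hZ hindep (show m + (N - m) ≤ N + 1 by omega) x y z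
    (box α N) (mul_pos hC h4) (fun w hw => le_trans
      (Finset.sum_le_sum_of_subset_of_nonneg (Finset.range_mono (by omega))
        (fun k _ _ => Finset.sum_nonneg fun w' _ => pow_nonneg (heat_nonneg _ _ _) 3))
      (h1 w hw)) rfl
  set M := ∑ j ∈ Finset.Ico 1 (N - m), ∑ w ∈ box α N, heat (combLog α) j (x m) w *
    heat (combLog α) j (y m) w * heat (combLog α) j (z m) w
  calc _ ≤ M / (8 * (C * rate α N)) * P.real (jointHistory X Y Z m x y z) := by
        refine mul_le_mul_of_nonneg_right ?_ measureReal_nonneg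
        rw [div_le_div_iff₀ (by positivity) (by positivity)]
        have := mul_le_mul_of_nonneg_left h2 (show 0 ≤ 8 * 508032 * C by positivity)
        linarith
    _ ≤ _ := h
    _ ≤ _ := by
        refine measureReal_mono (Set.inter_subset_inter_right _ fun ω hω => ?_)
        have hω' : M / 2 ≤ tripleCollisions (fun n => X n ω) (fun n => Y n ω) (fun n => Z n ω) N :=
          hω
        refine le_trans ?_ hω'
        linarith

end MainTheorem

theorem theorem1p2 (α : ℝ) (hα0 : 0 ≤ α) (hα1 : α ≤ 1)
    {Ω : Type*} [MeasurableSpace Ω] (P : Measure Ω) [IsProbabilityMeasure P]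
    (X Y Z : ℕ → Ω → combLogVertices α)
    (hX : IsSimpleRandomWalk (combLog α) (combLogOrigin α) P X)
    (hY : IsSimpleRandomWalk (combLog α) (combLogOrigin α) P Y)
    (hZ : IsSimpleRandomWalk (combLog α) (combLogOrigin α) P Z)
    (hindep : iIndepFun ![fun ω n => X n ω, fun ω n => Y n ω, fun ω n => Z n ω] P) :
    ∀ᵐ ω ∂P, (0 : EReal) < limsup (fun N : ℕ =>
      (((tripleCollisions (fun n => X n ω) (fun n => Y n ω) (fun n => Z n ω) N : ℝ) /
        max (Real.log N ^ (1 - α)) (Real.log (Real.log N)) : ℝ) : EReal)) atTop := by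
  obtain ⟨c, δ, hc, hδ, h⟩ := exists_eventually_real_collisions_ge hα0 hα1 hX hY hZ hindep
  set W : ℕ → Ω → combLogVertices α × combLogVertices α × combLogVertices α :=
    fun n ω => (X n ω, Y n ω, Z n ω)
  have hW : ∀ n, Measurable (W n) := fun n =>
    (hX.measurable n).prodMk ((hY.measurable n).prodMk (hZ.measurable n))
  set B : ℕ → Set (ℕ → combLogVertices α × combLogVertices α × combLogVertices α) := fun N =>
    {p | c * rate α N ≤
      tripleCollisions (fun n => (p n).1) (fun n => (p n).2.1) (fun n => (p n).2.2) N}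
  have hB : ∀ N, MeasurableSet (B N) := fun N =>
    measurableSet_le measurable_const (measurable_tripleCollisions N)
  have hA : MeasurableSet {p | ∃ᶠ N in atTop, p ∈ B N} := by
    have e : {p | ∃ᶠ N in atTop, p ∈ B N} = limsup B atTop := by
      ext p; exact mem_limsup_iff_frequently_mem.symm
    rw [e]
    exact MeasurableSet.measurableSet_limsup hB
  have hpath : Measurable fun ω k => W k ω := measurable_pi_lambda _ hW
  -- The zero-one argument is applied to the joint process, whose histories are exactly the joint
  -- histories of the three walks.
  have hzero := measure_eq_zero_of_history_atoms (P := P) hW hA hδ fun m t => by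
    have e : {ω | ∀ k ≤ m, W k ω = t k} =
        jointHistory X Y Z m (fun k => (t k).1) (fun k => (t k).2.1) (fun k => (t k).2.2) := by
      ext ω
      simp only [jointHistory, Set.mem_ofPred_eq, Set.mem_inter_iff, W, Prod.ext_iff]
      exact ⟨fun h => ⟨⟨fun k hk => (h k hk).1, fun k hk => (h k hk).2.1⟩,
        fun k hk => (h k hk).2.2⟩, fun h k hk => ⟨h.1.1 k hk, h.1.2 k hk, h.2 k hk⟩⟩
    rw [e]
    exact real_inter_frequently_ge
      (measurableSet_jointHistory hX.measurable hY.measurable hZ.measurable _ _ _ _)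
      (B := fun N => (fun ω k => W k ω) ⁻¹' B N) (fun N => hpath (hB N)) (h m _ _ _)
  have hae : ∀ᵐ ω ∂P, ∃ᶠ N in atTop, (fun k => W k ω) ∈ B N := by
    rw [ae_iff]; exact hzero
  filter_upwards [hae] with ω hω
  refine lt_of_lt_of_le (show (0 : EReal) < (c : ℝ) by exact_mod_cast hc)
    (le_limsup_of_frequently_le ?_)
  refine (hω.and_eventually ((tendsto_rate (α := α)).eventually_gt_atTop 0)).mono ?_
  rintro N ⟨h1, h2⟩
  exact EReal.coe_le_coe_iff.2 ((le_div_iff₀ h2).2 h1)
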